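/- **ε-parity automata.** An $\varepsilon$-parity automaton $\mathbb A=(A,\Delta_b,\Delta_\varepsilon,a_I,\Omega)$ over an alphabet $\Sigma$ consists of a finite set $A$ of states, basic transitions $\Delta_b:A\times\Sigma\to\mathcal P(A)$, $\varepsilon$-transitions $\Delta_\varepsilon:A\to\mathcal P(A)$, an initial state $a_I\in A$ with $\Delta_\varepsilon(a_I)=\varnothing$, and a priority map $\Omega:A\to\mathbb N$. A run of $\mathbb A$ on $w=z_0z_1\cdots\in\Sigma^\omega$ is an infinite sequence $(a_0,n_0)(a_1,n_1)\cdots$ in $A\times\mathbb N$ such that $(a_0,n_0)=(a_I,0)$, for every $i$ either $a_{i+1}\in\Delta_b(a_i,z_{n_i})$ and $n_{i+1}=n_i+1$, or $a_{i+1}\in\Delta_\varepsilon(a_i)$ and $n_{i+1}=n_i$, and the sequence $(n_i)_i$ is unbounded (the whole word is read). The run is accepting if the maximal priority occurring infinitely often in $\Omega(a_0)\Omega(a_1)\cdots$ is even, and $L(\mathbb A)$ is the set of words that have an accepting run. **The automaton $\mathbb A^S$.** For every even $k$ let there be countably many *$k$-names* $(k,0),(k,1),\dots$; $k$ is the *level*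 of such a name. A *stack* is a finite sequence of names (its last entry being the top), and a *control* is a finite list of names, read as a linear order. A *Safra-state* $(M,f,\theta,c)$ consists of a macrostate $M\subseteq A$, a map $f$ from $M$ to stacks, a control $\theta$ and a colouring $c$ of names by green and white. We write $a^\tau$ for the pair of a state $a\in M$ and its stack $\tau=f(a)$. A name is *in play* (active) if it occurs in some stack. A $k$-name is *invisible* if it is in play and in each stack in which it occurs there is another $k$-name above it. *Registering* a priority $k$ in a stack $\tau$, relative to a control $\theta$, means: delete from $\tau$ all names of level $<k$ and, if $k$ is even, take the $k$-name of least index that does not occur in $\theta$ and add it to the top of the stack and to the end of $\theta$. For a control $\theta$, stacks are strictly ordered as follows. Let $p$ be the first place at which $\sigma\neq\tau$ differ. Then $\sigma<_\theta\tau$ if $\tau$ has no $p$-th entry; or if both have a $p$-th entry and that of $\sigma$ has higher level than that of $\tau$; or if both $p$-th entries have the same level and that of $\sigma$ comes first in $\theta$. The initial Safra-state is $\{a_I^{\varepsilon}\}$ with the empty stack $\varepsilon$, empty control and all names white. The successor of a Safra-state $S=(M,f,\theta,c)$ under a letter $z$ is computed as follows. 1. *Basic transitions.* Form the set of all $b^\tau$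 such that $a^\tau\in S$ and $b\in\Delta_b(a,z)$ for some $a$. 2. *Priorities.* For each $b^\tau$ from step 1, one after the other in a fixed order and with the control updated each time, register $\Omega(b)$ in $\tau$. 3. *$\varepsilon$-transitions.* Keep the pairs $b^\sigma$ from step 2. Moreover, for each such $b^\sigma$, each state $c$ and each $k$ for which there is a nonempty path of $\varepsilon$-transitions $b=b_0,b_1,\dots,b_m=c$ with $k=\max_{1\le i\le m}\Omega(b_i)$, add $c$ together with the stack that results from $\sigma$ by registering $k$ (again one after the other in a fixed order, updating the control). 4. *Thinning.* For each state keep only its $<_\theta$-least stack, $\theta$ being the current control. 5. *Reset.* For each invisible name $x$ remove, in all stacks in which $x$ occurs, everything above $x$. 6. *Control and colouring.* Delete from the control all names that are no longer in play. A name in play is green if it was invisible before step 5; all other names are white. A run of the deterministic automaton $\mathbb A^S$ is accepting if some name is active (in play) in cofinitely many of its Safra-states and green in infinitely many of them. $L(\mathbb A^S)$ is the set of words on which the unique run of $\mathbb A^S$ is accepting. **Theorem (correctness of determinisation).** For every $\varepsilon$-parity automaton $\mathbb A$, the deterministic automaton $\mathbb A^S$ has only finitely many reachable states and is equivalent to $\mathbb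 A$: $L(\mathbb A^S)=L(\mathbb A)$. -/

import Mathlib

/-- A nondeterministic `ε`-parity automaton over the alphabet `Sig` with state space `A`:
basic transitions `Δ_b : A × Sig → 𝒫(A)`, `ε`-transitions `Δ_ε : A → 𝒫(A)`, an initial state
and a priority function. -/
structure EpsParityAutomaton (Sig A : Type*) where
  basic : A → Sig → Set A
  eps : A → Set A
  init : A
  prio : A → ℕ

/-- A deterministic automaton on infinite words over `Sig`, with states `Q`. The acceptance
condition is a set of infinite sequences of states. -/
structure DetOmegaAutomaton (Sig Q : Type*) where
  init : Q
  next : Q → Sig → Q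
  acc : Set (ℕ → Q)

namespace DetOmegaAutomaton

variable {Sig Q : Type*}

/-- The unique run of a deterministic automaton on the word `w`. -/
def run (D : DetOmegaAutomaton Sig Q) (w : ℕ → Sig) : ℕ → Q
  | 0 => D.init
  | j + 1 => D.next (D.run w j) (w j)

/-- The set of accepted infinite words. -/
def language (D : DetOmegaAutomaton Sig Q) : Set (ℕ → Sig) :=
  {w | D.run w ∈ D.acc}

/-- The states that can be reached from the initial state. -/
inductive Reachable (D : DetOmegaAutomaton Sig Q) : Q → Prop
  | init : Reachable D D.init
  | next (S : Q) (z : Sig) : Reachable D S → Reachable D (D.next S z)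

end DetOmegaAutomaton

namespace EpsParityAutomaton

variable {Sig A : Type*}

/-- `(a 0, n 0) (a 1, n 1) ⋯` is a run on `w`: it starts in the initial state at position `0`,
each step is either a basic transition reading the letter at the current position and moving
on to the next position, or an `ε`-transition that stays at the current position; and the whole
word is read. -/
structure IsRun (𝔸 : EpsParityAutomaton Sig A) (w : ℕ → Sig) (a : ℕ → A) (n : ℕ → ℕ) :
    Prop where
  state_zero : a 0 = 𝔸.init
  pos_zero : n 0 = 0
  step : ∀ i, (a (i + 1) ∈ 𝔸.basic (a i) (w (n i)) ∧ n (i + 1) = n i + 1) ∨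
    (a (i + 1) ∈ 𝔸.eps (a i) ∧ n (i + 1) = n i)
  reads_all : ∀ m, ∃ i, m ≤ n i

/-- The parity condition: the maximal priority that occurs infinitely often is even. -/
def Acc (𝔸 : EpsParityAutomaton Sig A) : Set (ℕ → A) :=
  {a | ∃ k, Even k ∧ (∃ᶠ i in Filter.atTop, 𝔸.prio (a i) = k) ∧
    ∀ᶠ i in Filter.atTop, 𝔸.prio (a i) ≤ k}

/-- The infinite words accepted by a nondeterministic `ε`-parity automaton. -/
def language (𝔸 : EpsParityAutomaton Sig A) : Set (ℕ → Sig) :=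
  {w | ∃ a n, 𝔸.IsRun w a n ∧ a ∈ 𝔸.Acc}

/-- `𝔸.EpsPath b k c`: there is a nonempty path `b = b₀, b₁, …, bₘ = c` of `ε`-transitions such
that `k` is the maximum of the priorities of `b₁, …, bₘ`. -/
inductive EpsPath (𝔸 : EpsParityAutomaton Sig A) (b : A) : ℕ → A → Prop
  | single (c : A) : c ∈ 𝔸.eps b → EpsPath 𝔸 b (𝔸.prio c) c
  | snoc (k : ℕ) (c d : A) : EpsPath 𝔸 b k c → d ∈ 𝔸.eps c →
      EpsPath 𝔸 b (max k (𝔸.prio d)) d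

end EpsParityAutomaton

namespace Safra

/-- A name. A name `x` with `x.level = k` is called a `k`-name. Only `k`-names with `k` even are
ever used. -/
@[ext]
structure Name where
  level : ℕ
  index : ℕ

/-- A stack of names; the last entry of the list is the top of the stack. -/
abbrev Stack := List Name

/-- A control: a finite linear order on names, given by listing the names in ascending order. -/
abbrev Control := List Name

inductive Colour
  | white
  | green

/-- A Safra-state `(M, f, θ, c)`: the partial function `stack` combines the macrostate
`M = {a | stack a ≠ none}` with the map `f` from `M` to stacks; `control` is a linear order of the
names in play and `colour` colours the names (those that are not in play are white). -/
@[ext]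
structure State (A : Type*) where
  stack : A → Option Stack
  control : Control
  colour : Name → Colour

/-- The `k`-name of least index that does not occur in `θ`. -/
noncomputable def fresh (k : ℕ) (θ : Control) : Name :=
  ⟨k, sInf {i | (⟨k, i⟩ : Name) ∉ θ}⟩

/-- Registering the priority `k` in a stack `τ`: all names of level smaller than `k` are removed
and, if `k` is even, a fresh `k`-name is put on top of the stack and at the end of the control.
The value consists of the new control and the new stack. -/
noncomputable def register (k : ℕ) (θ : Control) (τ : Stack) : Control × Stack :=
  if Even k then
    (θ ++ [fresh k θ], τ.filter (fun x => k ≤ x.level) ++ [fresh k θ])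
  else (θ, τ.filter (fun x => k ≤ x.level))

/-- Registers priorities, one after the other, in the stacks of a list of annotated states. -/
noncomputable def registerAll {A : Type*} :
    Control → List (A × ℕ × Stack) → Control × List (A × Stack)
  | θ, [] => (θ, [])
  | θ, (b, k, τ) :: L =>
    ((registerAll (register k θ τ).1 L).1,
      (b, (register k θ τ).2) :: (registerAll (register k θ τ).1 L).2)

open Classical in
/-- The strict order of stacks for a control `θ`. At the first place where two stacks differ, a
present name is smaller than no name, a name of higher level is smaller than one of lower level,
and for names of the same level the order is that of `θ`. -/
noncomputable def stackLT (θ : Control) : Stack → Stack → Prop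
  | [], _ => False
  | _ :: _, [] => True
  | x :: σ, y :: τ =>
    if x = y then stackLT θ σ τ
    else y.level < x.level ∨ (x.level = y.level ∧ θ.idxOf x < θ.idxOf y)

open Classical in
/-- Thinning: for every state `a` only the least stack `τ` with `a^τ` in the list is kept. -/
noncomputable def thin {A : Type*} (θ : Control) (L : List (A × Stack)) (a : A) : Option Stack :=
  ((L.filter (fun p => p.1 = a)).map Prod.snd).find?
    (fun τ => ∀ σ, (a, σ) ∈ L → ¬ stackLT θ σ τ)

/-- A name is in play if it occurs in some stack. -/
def InPlay {A : Type*} (f : A → Option Stack) (x : Name) : Prop :=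
  ∃ a τ, f a = some τ ∧ x ∈ τ

/-- A `k`-name is invisible if it is in play and, in each stack in which it occurs, there is a
`k`-name above it. -/
def Invisible {A : Type*} (f : A → Option Stack) (x : Name) : Prop :=
  InPlay f x ∧ ∀ a ρ σ, f a = some (ρ ++ x :: σ) → ∃ y ∈ σ, y.level = x.level

open Classical in
/-- Removes everything above the lowest name of the stack that satisfies `P`. -/
noncomputable def cut (P : Name → Prop) : Stack → Stack
  | [] => []
  | x :: τ => if P x then [x] else x :: cut P τ

/-- Resetting the invisible names: in every stack, everything above an invisible name is
removed. -/
noncomputable def reset {A : Type*} (f : A → Option Stack) (a : A) : Option Stack :=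
  (f a).map (cut (Invisible f))

end Safra

namespace EpsParityAutomaton

open Safra

variable {Sig A : Type*} [Fintype A]

open Classical in
/-- Step 1, basic transitions: all `b^τ` with `b ∈ Δ_b(a, z)` for some `a^τ` in `S`. -/
noncomputable def safraBasic (𝔸 : EpsParityAutomaton Sig A) (S : State A) (z : Sig) :
    List (A × Stack) :=
  ((Finset.univ : Finset A).toList.flatMap fun a =>
    match S.stack a with
    | none => []
    | some τ => ((Finset.univ : Finset A).toList.filter (fun b => b ∈ 𝔸.basic a z)).map
        (fun b => (b, τ))).dedup

/-- Step 2: the priority of `b` is registered in `τ`, for each `b^τ` obtained in step 1. -/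
noncomputable def safraPrio (𝔸 : EpsParityAutomaton Sig A) (S : State A) (z : Sig) :
    Control × List (A × Stack) :=
  registerAll S.control ((𝔸.safraBasic S z).map fun p => (p.1, 𝔸.prio p.1, p.2))

open Classical in
/-- Step 3, `ε`-transitions: for each `b^σ` obtained in step 2 and each nonempty `ε`-path from `b`
to `c` with maximal priority `k`, add `c` with the stack that results from `σ` by registering
`k`. -/
noncomputable def safraEps (𝔸 : EpsParityAutomaton Sig A) (S : State A) (z : Sig) :
    Control × List (A × Stack) :=
  let P := 𝔸.safraPrio S z
  let E := registerAll P.1 (P.2.flatMap fun p =>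
    (Finset.univ : Finset A).toList.flatMap fun c =>
      ((List.range ((Finset.univ : Finset A).sup 𝔸.prio + 1)).filter
        (fun k => 𝔸.EpsPath p.1 k c)).map (fun k => (c, k, p.2)))
  (E.1, P.2 ++ E.2)

/-- Step 4, thinning. -/
noncomputable def safraThin (𝔸 : EpsParityAutomaton Sig A) (S : State A) (z : Sig) :
    A → Option Stack :=
  thin (𝔸.safraEps S z).1 (𝔸.safraEps S z).2

open Classical in
/-- The transition function of the Safra automaton. After steps 1 to 4 the invisible names are
reset (step 5); then the names that are not in play any more are deleted from the control, and
a name in play is coloured green if it has just been reset and white otherwise (step 6). -/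
noncomputable def safraNext (𝔸 : EpsParityAutomaton Sig A) (S : State A) (z : Sig) : State A where
  stack := reset (𝔸.safraThin S z)
  control := (𝔸.safraEps S z).1.filter (fun x => InPlay (reset (𝔸.safraThin S z)) x)
  colour := fun x =>
    if Invisible (𝔸.safraThin S z) x ∧ InPlay (reset (𝔸.safraThin S z)) x then Colour.green
    else Colour.white

open Classical in
/-- The deterministic automaton `𝔸^S`. Its initial state is `{a_I^ε}`, where `ε` is the empty
stack. A run is accepting if some name is active (that is, in play) cofinitely often and coloured
green infinitely often. -/
noncomputable def safra (𝔸 : EpsParityAutomaton Sig A) : DetOmegaAutomaton Sig (State A) where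
  init :=
    { stack := fun a => if a = 𝔸.init then some [] else none
      control := []
      colour := fun _ => Colour.white }
  next := 𝔸.safraNext
  acc := {ρ | ∃ x : Name, (∀ᶠ j in Filter.atTop, InPlay (ρ j).stack x) ∧
    ∃ᶠ j in Filter.atTop, (ρ j).colour x = Colour.green}

end EpsParityAutomaton

namespace Safra

variable {A : Type*}

/-! ### Fresh names and registration -/

theorem exists_index_not_mem (k : ℕ) (θ : Control) :
    ∃ i ≤ θ.length, (⟨k, i⟩ : Name) ∉ θ := by
  classical
  by_contra! h
  have hsub : (Finset.range (θ.length + 1)).image (fun i => (⟨k, i⟩ : Name)) ⊆ θ.toFinset := by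
    intro x hx
    obtain ⟨i, hi, rfl⟩ := Finset.mem_image.1 hx
    exact List.mem_toFinset.2 (h i (by simpa [Nat.lt_succ_iff] using hi))
  have hcard := Finset.card_le_card hsub
  rw [Finset.card_image_of_injective _ (fun i j hij => congrArg Name.index hij),
    Finset.card_range] at hcard
  have := θ.toFinset_card_le
  omega

theorem fresh_not_mem (k : ℕ) (θ : Control) : fresh k θ ∉ θ := by
  obtain ⟨i, -, hi⟩ := exists_index_not_mem k θ
  exact Nat.sInf_mem (s := {i | (⟨k, i⟩ : Name) ∉ θ}) ⟨i, hi⟩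

theorem fresh_index_le (k : ℕ) (θ : Control) : (fresh k θ).index ≤ θ.length := by
  obtain ⟨i, hle, hi⟩ := exists_index_not_mem k θ
  exact (Nat.sInf_le (s := {i | (⟨k, i⟩ : Name) ∉ θ}) hi).trans hle

/-- `υ` results from `τ` by registering priorities with maximum `m`, all new names being outside
of `θ`. -/
def IsRegistration (θ : Control) (τ : Stack) (m : ℕ) (υ : Stack) : Prop :=
  ∃ ν : Stack, υ = τ.filter (fun x => m ≤ x.level) ++ ν ∧ (∀ y ∈ ν, y ∉ θ ∧ y.level ≤ m) ∧
    (Even m → ∃ y ν', ν = y :: ν' ∧ y.level = m)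

theorem isRegistration_register {θ θ' : Control} (h : θ ⊆ θ') (k : ℕ) (τ : Stack) :
    IsRegistration θ τ k (register k θ' τ).2 := by
  unfold register
  split_ifs with hk
  · refine ⟨[fresh k θ'], rfl, ?_, fun _ => ⟨_, _, rfl, rfl⟩⟩
    intro y hy
    rw [List.mem_singleton] at hy
    subst hy
    exact ⟨fun hy => fresh_not_mem k θ' (h hy), le_rfl⟩
  · exact ⟨[], by simp, by simp, fun h => absurd h hk⟩

theorem IsRegistration.trans {θ : Control} {τ σ υ : Stack} {p q : ℕ}
    (h₁ : IsRegistration θ τ p σ) (h₂ : IsRegistration θ σ q υ) :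
    IsRegistration θ τ (max p q) υ := by
  obtain ⟨ν₁, rfl, hν₁, he₁⟩ := h₁
  obtain ⟨ν₂, rfl, hν₂, he₂⟩ := h₂
  refine ⟨ν₁.filter (fun x => q ≤ x.level) ++ ν₂, ?_, ?_, ?_⟩
  · rw [List.filter_append, List.filter_filter, List.append_assoc]
    congr 2
    funext x
    by_cases h1 : p ≤ x.level <;> by_cases h2 : q ≤ x.level <;> simp [h1, h2]
  · intro y hy
    rcases List.mem_append.1 hy with hy | hy
    · have := hν₁ y (List.mem_of_mem_filter hy)
      exact ⟨this.1, this.2.trans (le_max_left _ _)⟩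
    · have := hν₂ y hy
      exact ⟨this.1, this.2.trans (le_max_right _ _)⟩
  · intro he
    rcases le_or_gt q p with hqp | hpq
    · rw [max_eq_left hqp] at he ⊢
      obtain ⟨y, ν', rfl, hy⟩ := he₁ he
      exact ⟨y, ν'.filter (fun x => q ≤ x.level) ++ ν₂, by simp [hy, hqp], hy⟩
    · rw [max_eq_right hpq.le] at he ⊢
      obtain ⟨y, ν', rfl, hy⟩ := he₂ he
      refine ⟨y, ν', ?_, hy⟩
      have : ν₁.filter (fun x => q ≤ x.level) = [] := by
        rw [List.filter_eq_nil_iff]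
        intro x hx
        have := (hν₁ x hx).2
        simp only [decide_eq_true_eq]
        omega
      rw [this, List.nil_append]

theorem control_prefix_register (k : ℕ) (θ : Control) (τ : Stack) :
    θ <+: (register k θ τ).1 := by
  unfold register
  split_ifs <;> simp

/-! ### Coherent sets of stacks -/

theorem concat_eq_split {τ ρ σ : Stack} {x y : Name} (h : τ ++ [x] = ρ ++ y :: σ) :
    (y = x ∧ ρ = τ) ∨ ∃ σ', τ = ρ ++ y :: σ' := by
  rcases σ.eq_nil_or_concat with rfl | ⟨σ', z, rfl⟩
  · have := List.append_inj' h rfl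
    simp only [List.cons.injEq, and_true] at this
    exact Or.inl ⟨this.2.symm, this.1.symm⟩
  · right
    refine ⟨σ', ?_⟩
    have h' : τ ++ [x] = (ρ ++ y :: σ') ++ [z] := by simpa using h
    exact (List.append_inj' h' rfl).1

/-- The stacks in `T` use names from the control `θ`, the levels decrease weakly from bottom to
top, and the part of a stack below a name is determined by that name. -/
structure Coherent (θ : Control) (T : Set Stack) : Prop where
  mem_control : ∀ τ ∈ T, ∀ x ∈ τ, x ∈ θ
  sorted : ∀ τ ∈ T, τ.Pairwise (fun x y => y.level ≤ x.level)
  below : ∀ τ ∈ T, ∀ τ' ∈ T, ∀ x ρ σ ρ' σ', τ = ρ ++ x :: σ → τ' = ρ' ++ x :: σ' → ρ = ρ'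

namespace Coherent

theorem of_prefix {θ : Control} {T T' : Set Stack} (h : Coherent θ T)
    (hT : ∀ τ' ∈ T', ∃ τ ∈ T, τ' <+: τ) : Coherent θ T' where
  mem_control τ' hτ' x hx := by
    obtain ⟨τ, hτ, hp⟩ := hT τ' hτ'
    exact h.mem_control τ hτ x (hp.subset hx)
  sorted τ' hτ' := by
    obtain ⟨τ, hτ, hp⟩ := hT τ' hτ'
    exact (h.sorted τ hτ).sublist hp.sublist
  below τ₁ h₁ τ₂ h₂ x ρ σ ρ' σ' e₁ e₂ := by
    obtain ⟨τ₁', h₁', r₁, rfl⟩ := hT τ₁ h₁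
    obtain ⟨τ₂', h₂', r₂, rfl⟩ := hT τ₂ h₂
    exact h.below _ h₁' _ h₂' x ρ (σ ++ r₁) ρ' (σ' ++ r₂) (by simp [e₁]) (by simp [e₂])

theorem mono {θ : Control} {T T' : Set Stack} (h : Coherent θ T) (hT : T' ⊆ T) :
    Coherent θ T' :=
  h.of_prefix fun τ hτ => ⟨τ, hT hτ, List.prefix_rfl⟩

theorem insert_concat {θ : Control} {T : Set Stack} (h : Coherent θ T) {τ : Stack} (hτ : τ ∈ T)
    {x : Name} (hx : x ∉ θ) (hl : ∀ y ∈ τ, x.level ≤ y.level) :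
    Coherent (θ ++ [x]) (insert (τ ++ [x]) T) where
  mem_control := by
    rintro σ (rfl | hσ) y hy
    · rcases List.mem_append.1 hy with hy | hy
      · exact List.mem_append_left _ (h.mem_control τ hτ y hy)
      · exact List.mem_append_right _ hy
    · exact List.mem_append_left _ (h.mem_control σ hσ y hy)
  sorted := by
    rintro σ (rfl | hσ)
    · rw [List.pairwise_append]
      refine ⟨h.sorted τ hτ, by simp, ?_⟩
      intro y hy z hz
      rw [List.mem_singleton] at hz
      exact hz ▸ hl y hy
    · exact h.sorted σ hσ
  below := by
    have key : ∀ σ ∈ T, ∀ ρ r, σ = ρ ++ x :: r → False := fun σ hσ ρ r e =>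
      hx (h.mem_control σ hσ x (by simp [e]))
    rintro τ₁ (rfl | h₁) τ₂ (rfl | h₂) y ρ σ ρ' σ' e₁ e₂
    · rcases concat_eq_split e₁ with ⟨rfl, rfl⟩ | ⟨r₁, e₁⟩ <;>
        rcases concat_eq_split e₂ with ⟨h2, h3⟩ | ⟨r₂, e₂⟩
      · exact h3.symm
      · exact (key _ hτ _ _ e₂).elim
      · exact (key _ hτ _ _ (h2 ▸ e₁)).elim
      · exact h.below _ hτ _ hτ y _ _ _ _ e₁ e₂
    · rcases concat_eq_split e₁ with ⟨rfl, rfl⟩ | ⟨r₁, e₁⟩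
      · exact (key _ h₂ _ _ e₂).elim
      · exact h.below _ hτ _ h₂ y _ _ _ _ e₁ e₂
    · rcases concat_eq_split e₂ with ⟨rfl, rfl⟩ | ⟨r₁, e₂⟩
      · exact (key _ h₁ _ _ e₁).elim
      · exact h.below _ h₁ _ hτ y _ _ _ _ e₁ e₂
    · exact h.below _ h₁ _ h₂ y _ _ _ _ e₁ e₂

end Coherent

theorem filter_level_prefix {τ : Stack} (h : τ.Pairwise (fun x y => y.level ≤ x.level)) (k : ℕ) :
    τ.filter (fun x => k ≤ x.level) <+: τ := by
  induction τ with
  | nil => simp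
  | cons x τ ih =>
    rw [List.pairwise_cons] at h
    by_cases hx : k ≤ x.level
    · simpa [hx] using ih h.2
    · have : (x :: τ).filter (fun x => k ≤ x.level) = [] := by
        rw [List.filter_eq_nil_iff]
        intro y hy
        rcases List.mem_cons.1 hy with rfl | hy
        · simpa using hx
        · have := h.1 y hy
          simp only [decide_eq_true_eq]
          omega
      rw [this]
      exact List.nil_prefix

theorem Coherent.insert_register {θ : Control} {T : Set Stack} (h : Coherent θ T) {τ : Stack}
    (hτ : τ ∈ T) (k : ℕ) :
    Coherent (register k θ τ).1 (insert (register k θ τ).2 T) := by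
  have h' : Coherent θ (insert (τ.filter (fun x => k ≤ x.level)) T) := by
    refine h.of_prefix ?_
    rintro σ (rfl | hσ)
    · exact ⟨τ, hτ, filter_level_prefix (h.sorted τ hτ) k⟩
    · exact ⟨σ, hσ, List.prefix_rfl⟩
  unfold register
  split_ifs with hk
  · refine (h'.insert_concat (Set.mem_insert _ _) (fresh_not_mem k θ) ?_).mono ?_
    · intro y hy
      exact of_decide_eq_true (List.mem_filter.1 hy).2
    · exact Set.insert_subset_insert (Set.subset_insert _ _)
  · exact h'

/-! ### Registering in a list -/

theorem control_prefix_registerAll (θ : Control) (L : List (A × ℕ × Stack)) :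
    θ <+: (registerAll θ L).1 := by
  induction L generalizing θ with
  | nil => exact List.prefix_rfl
  | cons p L ih => exact (control_prefix_register _ _ _).trans (ih _)

theorem exists_register_of_mem_registerAll {θ : Control} {L : List (A × ℕ × Stack)} {b : A}
    {υ : Stack} (h : (b, υ) ∈ (registerAll θ L).2) :
    ∃ k τ θ', (b, k, τ) ∈ L ∧ θ ⊆ θ' ∧ υ = (register k θ' τ).2 := by
  induction L generalizing θ with
  | nil => simp [registerAll] at h
  | cons p L ih =>
    obtain ⟨c, k, τ⟩ := p
    rcases List.mem_cons.1 h with h | h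
    · rw [Prod.mk.injEq] at h
      obtain ⟨rfl, rfl⟩ := h
      exact ⟨k, τ, θ, by simp, List.Subset.refl _, rfl⟩
    · obtain ⟨k', τ', θ', hm, hs, he⟩ := ih h
      exact ⟨k', τ', θ', List.mem_cons_of_mem _ hm,
        List.Subset.trans (control_prefix_register k θ τ).subset hs, he⟩

theorem exists_mem_registerAll {L : List (A × ℕ × Stack)} {b : A} {k : ℕ}
    {τ : Stack} (θ : Control) (h : (b, k, τ) ∈ L) :
    ∃ θ', θ ⊆ θ' ∧ (b, (register k θ' τ).2) ∈ (registerAll θ L).2 := by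
  induction L generalizing θ with
  | nil => simp at h
  | cons p L ih =>
    obtain ⟨c, k', τ'⟩ := p
    rcases List.mem_cons.1 h with h | h
    · cases h
      exact ⟨θ, List.Subset.refl _, List.mem_cons_self⟩
    · obtain ⟨θ', hs, hm⟩ := ih (register k' θ τ').1 h
      exact ⟨θ', List.Subset.trans (control_prefix_register k' θ τ').subset hs,
        List.mem_cons_of_mem _ hm⟩

theorem length_registerAll (θ : Control) (L : List (A × ℕ × Stack)) :
    (registerAll θ L).2.length = L.length := by
  induction L generalizing θ with
  | nil => rfl
  | cons p L ih => simp [registerAll, ih]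

theorem Coherent.registerAll {θ : Control} {T : Set Stack} (h : Coherent θ T)
    {L : List (A × ℕ × Stack)} (hL : ∀ p ∈ L, p.2.2 ∈ T) :
    Coherent (registerAll θ L).1 (T ∪ {υ | ∃ b, (b, υ) ∈ (registerAll θ L).2}) := by
  induction L generalizing θ T with
  | nil => exact h.mono (by simp [Safra.registerAll])
  | cons p L ih =>
    obtain ⟨c, k, τ⟩ := p
    have h1 := h.insert_register (hL _ List.mem_cons_self) k
    have h2 := ih h1 (fun p hp => Set.mem_insert_of_mem _ (hL p (List.mem_cons_of_mem _ hp)))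
    refine h2.mono ?_
    rintro υ (hυ | ⟨b, hb⟩)
    · exact Or.inl (Set.mem_insert_of_mem _ hυ)
    · rcases List.mem_cons.1 hb with hb | hb
      · rw [Prod.mk.injEq] at hb
        exact Or.inl (hb.2 ▸ Set.mem_insert _ _)
      · exact Or.inr ⟨b, hb⟩

theorem length_control_registerAll_le (θ : Control) (L : List (A × ℕ × Stack)) :
    (registerAll θ L).1.length ≤ θ.length + L.length := by
  induction L generalizing θ with
  | nil => simp [registerAll]
  | cons p L ih =>
    obtain ⟨c, k, τ⟩ := p
    refine (ih (register k θ τ).1).trans ?_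
    have : (register k θ τ).1.length ≤ θ.length + 1 := by
      unfold register
      split_ifs <;> simp
    simp only [List.length_cons]
    omega

theorem nodup_control_registerAll {θ : Control} (hθ : θ.Nodup) (L : List (A × ℕ × Stack)) :
    (registerAll θ L).1.Nodup := by
  induction L generalizing θ with
  | nil => exact hθ
  | cons p L ih =>
    obtain ⟨c, k, τ⟩ := p
    refine ih ?_
    unfold register
    split_ifs
    · exact List.nodup_append'.2 ⟨hθ, List.nodup_singleton _,
        List.disjoint_singleton.2 (fresh_not_mem k θ)⟩
    · exact hθ

theorem mem_control_registerAll {θ : Control} {L : List (A × ℕ × Stack)} {x : Name}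
    (h : x ∈ (registerAll θ L).1) :
    x ∈ θ ∨ Even x.level ∧ (∃ p ∈ L, p.2.1 = x.level) ∧ x.index ≤ θ.length + L.length := by
  induction L generalizing θ with
  | nil => exact Or.inl h
  | cons p L ih =>
    obtain ⟨c, k, τ⟩ := p
    have hlen : (register k θ τ).1.length ≤ θ.length + 1 := by
      unfold register
      split_ifs <;> simp
    rcases ih h with h | ⟨h1, ⟨p, h2, h3⟩, h4⟩
    · unfold register at h
      split_ifs at h with hk
      · rcases List.mem_append.1 h with h | h
        · exact Or.inl h
        · rw [List.mem_singleton] at h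
          subst h
          exact Or.inr ⟨hk, ⟨_, List.mem_cons_self, rfl⟩,
            (fresh_index_le k θ).trans (Nat.le_add_right _ _)⟩
      · exact Or.inl h
    · refine Or.inr ⟨h1, ⟨p, List.mem_cons_of_mem _ h2, h3⟩, ?_⟩
      simp only [List.length_cons]
      omega

/-! ### Thinning -/

theorem stackLT_irrefl (θ : Control) (σ : Stack) : ¬ stackLT θ σ σ := by
  induction σ with
  | nil => simp [stackLT]
  | cons x σ ih => simpa [stackLT] using ih

theorem stackLT_trans (θ : Control) : ∀ {σ τ υ : Stack}, stackLT θ σ τ → stackLT θ τ υ →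
    stackLT θ σ υ
  | [], _, _, h, _ => by simp [stackLT] at h
  | _ :: _, [], _, _, h => by simp [stackLT] at h
  | _ :: _, _ :: _, [], _, _ => by simp [stackLT]
  | x :: σ, y :: τ, z :: υ, h₁, h₂ => by
    simp only [stackLT] at h₁ h₂ ⊢
    by_cases hxy : x = y
    · subst hxy
      by_cases hxz : x = z
      · subst hxz
        simp only [if_true] at h₁ h₂ ⊢
        exact stackLT_trans θ h₁ h₂
      · simpa [hxz] using h₂
    · by_cases hyz : y = z
      · subst hyz
        simpa [hxy] using h₁
      · simp only [hxy, hyz, if_false] at h₁ h₂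
        have hxz : x ≠ z := by
          rintro rfl
          omega
        simp only [hxz, if_false]
        omega

open Classical in
theorem stackLT_total {θ : Control} : ∀ {σ τ : Stack}, (∀ x ∈ σ, x ∈ θ) → (∀ x ∈ τ, x ∈ θ) →
    σ = τ ∨ stackLT θ σ τ ∨ stackLT θ τ σ
  | [], [], _, _ => Or.inl rfl
  | [], _ :: _, _, _ => by simp [stackLT]
  | _ :: _, [], _, _ => by simp [stackLT]
  | x :: σ, y :: τ, hσ, hτ => by
    by_cases hxy : x = y
    · subst hxy
      have := stackLT_total (σ := σ) (τ := τ) (fun z hz => hσ z (List.mem_cons_of_mem _ hz))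
        (fun z hz => hτ z (List.mem_cons_of_mem _ hz))
      simpa [stackLT] using this
    · have hidx : θ.idxOf x ≠ θ.idxOf y := fun h =>
        hxy ((List.idxOf_inj (hσ x List.mem_cons_self)).1 h)
      simp only [stackLT, hxy, Ne.symm hxy, if_false]
      omega

theorem thin_spec {θ : Control} {L : List (A × Stack)} {a : A} {τ : Stack}
    (h : thin θ L a = some τ) : (a, τ) ∈ L ∧ ∀ σ, (a, σ) ∈ L → ¬ stackLT θ σ τ := by
  unfold thin at h
  refine ⟨?_, by simpa using List.find?_some h⟩
  have := List.mem_of_find?_eq_some h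
  simpa using this

theorem exists_thin_eq_some {θ : Control} {L : List (A × Stack)} {a : A} {σ : Stack}
    (h : (a, σ) ∈ L) : ∃ τ, thin θ L a = some τ := by
  classical
  have hfin : {τ : Stack | (a, τ) ∈ L}.Finite := by
    refine (List.finite_toSet (L.map Prod.snd)).subset ?_
    intro τ hτ
    exact List.mem_map.2 ⟨_, hτ, rfl⟩
  have : IsStrictOrder Stack (stackLT θ) :=
    { irrefl := stackLT_irrefl θ, trans := fun _ _ _ => stackLT_trans θ }
  obtain ⟨⟨τ, hτ⟩, -, hmin⟩ := (hfin.wellFoundedOn (r := stackLT θ)).has_min Set.univ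
    ⟨⟨σ, h⟩, trivial⟩
  rw [← Option.isSome_iff_exists]
  unfold thin
  rw [List.find?_isSome]
  refine ⟨τ, by simpa using hτ, ?_⟩
  simpa using fun σ hσ => hmin ⟨σ, hσ⟩ trivial

/-! ### Cutting -/

theorem cut_prefix (P : Name → Prop) (τ : Stack) : cut P τ <+: τ := by
  induction τ with
  | nil => simp [cut]
  | cons x τ ih =>
    unfold cut
    split_ifs
    · simp
    · simpa using ih

theorem cut_append {P : Name → Prop} {ρ : Stack} (h : ∀ x ∈ ρ, ¬ P x) (τ : Stack) :
    cut P (ρ ++ τ) = ρ ++ cut P τ := by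
  induction ρ with
  | nil => rfl
  | cons x ρ ih =>
    rw [List.cons_append, cut, if_neg (h x List.mem_cons_self),
      ih fun y hy => h y (List.mem_cons_of_mem _ hy), List.cons_append]

theorem exists_cut_cons (P : Name → Prop) (x : Name) (τ : Stack) :
    ∃ r, cut P (x :: τ) = x :: r ∧ r <+: τ := by
  unfold cut
  split_ifs
  · exact ⟨[], rfl, List.nil_prefix⟩
  · exact ⟨_, rfl, cut_prefix P τ⟩

theorem cut_eq_split {P : Name → Prop} {τ ρ σ : Stack} {x : Name}
    (h : cut P τ = ρ ++ x :: σ) : (∀ y ∈ ρ, ¬ P y) ∧ (P x → σ = []) := by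
  induction τ generalizing ρ with
  | nil => simp [cut] at h
  | cons y τ ih =>
    unfold cut at h
    split_ifs at h with hy
    · rcases ρ with _ | ⟨z, ρ⟩
      · simp_all
      · simp at h
    · rcases ρ with _ | ⟨z, ρ⟩
      · simp only [List.nil_append, List.cons.injEq] at h
        exact ⟨by simp, fun hx => absurd (h.1 ▸ hx) hy⟩
      · simp only [List.cons_append, List.cons.injEq] at h
        have := ih h.2
        refine ⟨?_, this.2⟩
        rintro w (_ | ⟨_, hw⟩)
        · exact h.1 ▸ hy
        · exact this.1 w hw

end Safra

namespace Safra

variable {A : Type*}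

/-- The set of stacks that occur in an annotation. -/
def stackSet (f : A → Option Stack) : Set Stack := {τ | ∃ a, f a = some τ}

/-- A name that is in play after a reset occurs, after the reset, in a stack without a name of the
same level above it. -/
theorem exists_top_of_inPlay_reset {θ : Control} {f : A → Option Stack}
    (hf : Coherent θ (stackSet f)) {x : Name} (hx : InPlay (reset f) x) :
    ∃ a ρ σ, reset f a = some (ρ ++ x :: σ) ∧ ∀ y ∈ σ, y.level ≠ x.level := by
  obtain ⟨a, τ', ha, hxτ⟩ := hx
  obtain ⟨τ, hτ, rfl⟩ := Option.map_eq_some_iff.1 ha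
  obtain ⟨ρ, σ, hs⟩ := List.append_of_mem hxτ
  obtain ⟨hρ, hσ⟩ := cut_eq_split hs
  by_cases hinv : Invisible f x
  · exact ⟨a, ρ, σ, by rw [ha, hs], by simp [hσ hinv]⟩
  · obtain ⟨r, hr⟩ := cut_prefix (Invisible f) τ
    have hτe : τ = ρ ++ x :: (σ ++ r) := by rw [← hr, hs]; simp
    have hplay : InPlay f x := ⟨a, τ, hτ, by simp [hτe]⟩
    have hex : ∃ a ρ σ, f a = some (ρ ++ x :: σ) ∧ ∀ y ∈ σ, y.level ≠ x.level := by
      by_contra! hcon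
      exact hinv ⟨hplay, hcon⟩
    obtain ⟨b, ρ', σ', hb, htop⟩ := hex
    have hρe : ρ = ρ' := hf.below _ ⟨a, hτ⟩ _ ⟨b, hb⟩ x _ _ _ _ hτe rfl
    subst hρe
    obtain ⟨s, hcut, hsp⟩ := exists_cut_cons (Invisible f) x σ'
    exact ⟨b, ρ, s, by rw [reset, hb, Option.map_some, cut_append hρ, hcut],
      fun y hy => htop y (hsp.subset hy)⟩

theorem eq_of_top {τ ρ σ ρ' σ' : Stack} {x y : Name} (hx : τ = ρ ++ x :: σ)
    (hy : τ = ρ' ++ y :: σ') (hxt : ∀ z ∈ σ, z.level ≠ x.level)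
    (hyt : ∀ z ∈ σ', z.level ≠ y.level) (hl : x.level = y.level) : x = y := by
  rw [hx, List.append_eq_append_iff] at hy
  rcases hy with ⟨a, rfl, ha⟩ | ⟨a, rfl, ha⟩
  · rcases a with _ | ⟨z, a⟩
    · exact (List.cons.inj ha).1
    · simp only [List.cons_append, List.cons.injEq] at ha
      exact absurd hl.symm (hxt y (by simp [ha.2]))
  · rcases a with _ | ⟨z, a⟩
    · exact (List.cons.inj ha).1.symm
    · simp only [List.cons_append, List.cons.injEq] at ha
      exact absurd hl (hyt x (by simp [ha.2]))

end Safra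

namespace EpsParityAutomaton

open Safra

variable {Sig A : Type*}

/-- `𝔸.MacroStep z a m c`: there is a path from `a` to `c` that reads `z` in its first transition
and continues with `ε`-transitions, and `m` is the maximal priority of the states after `a`. -/
def MacroStep (𝔸 : EpsParityAutomaton Sig A) (z : Sig) (a : A) (m : ℕ) (c : A) : Prop :=
  ∃ b ∈ 𝔸.basic a z, (m = 𝔸.prio b ∧ c = b) ∨ ∃ k, 𝔸.EpsPath b k c ∧ m = max (𝔸.prio b) k

variable [Fintype A]

theorem prio_le_sup (𝔸 : EpsParityAutomaton Sig A) (a : A) :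
    𝔸.prio a ≤ (Finset.univ : Finset A).sup 𝔸.prio :=
  Finset.le_sup (Finset.mem_univ a)

theorem EpsPath.le_sup {𝔸 : EpsParityAutomaton Sig A} {b c : A} {k : ℕ}
    (h : 𝔸.EpsPath b k c) : k ≤ (Finset.univ : Finset A).sup 𝔸.prio := by
  induction h with
  | single c hc => exact 𝔸.prio_le_sup c
  | snoc k c d hk hd ih => exact max_le ih (𝔸.prio_le_sup d)

theorem mem_safraBasic {𝔸 : EpsParityAutomaton Sig A} {S : State A} {z : Sig} {b : A}
    {τ : Stack} :
    (b, τ) ∈ 𝔸.safraBasic S z ↔ ∃ a, S.stack a = some τ ∧ b ∈ 𝔸.basic a z := by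
  classical
  unfold safraBasic
  rw [List.mem_dedup, List.mem_flatMap]
  constructor
  · rintro ⟨a, -, h⟩
    split at h
    · simp at h
    · rename_i τ' ha
      simp only [List.mem_map, List.mem_filter, Finset.mem_toList, Finset.mem_univ, true_and,
        decide_eq_true_eq, Prod.mk.injEq] at h
      obtain ⟨b', hb', rfl, rfl⟩ := h
      exact ⟨a, ha, hb'⟩
  · rintro ⟨a, ha, hb⟩
    exact ⟨a, by simp, by simp [ha, hb]⟩

theorem control_subset_safraPrio (𝔸 : EpsParityAutomaton Sig A) (S : State A) (z : Sig) :
    S.control ⊆ (𝔸.safraPrio S z).1 :=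
  (control_prefix_registerAll _ _).subset

theorem control_prefix_safraEps (𝔸 : EpsParityAutomaton Sig A) (S : State A) (z : Sig) :
    S.control <+: (𝔸.safraEps S z).1 :=
  (control_prefix_registerAll _ _).trans (control_prefix_registerAll _ _)

theorem exists_of_mem_safraPrio {𝔸 : EpsParityAutomaton Sig A} {S : State A} {z : Sig} {b : A}
    {υ : Stack} (h : (b, υ) ∈ (𝔸.safraPrio S z).2) :
    ∃ a τ, S.stack a = some τ ∧ b ∈ 𝔸.basic a z ∧ IsRegistration S.control τ (𝔸.prio b) υ := by
  obtain ⟨k, τ, θ', hm, hs, rfl⟩ := exists_register_of_mem_registerAll h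
  obtain ⟨⟨b', τ'⟩, hp, he⟩ := List.mem_map.1 hm
  obtain ⟨rfl, rfl, rfl⟩ : b' = b ∧ 𝔸.prio b' = k ∧ τ' = τ := by simpa using he
  obtain ⟨a, ha, hb⟩ := mem_safraBasic.1 hp
  exact ⟨a, τ', ha, hb, isRegistration_register hs _ _⟩

theorem exists_mem_safraPrio {𝔸 : EpsParityAutomaton Sig A} {S : State A} {z : Sig} {a b : A}
    {τ : Stack} (ha : S.stack a = some τ) (hb : b ∈ 𝔸.basic a z) :
    ∃ υ, (b, υ) ∈ (𝔸.safraPrio S z).2 ∧ IsRegistration S.control τ (𝔸.prio b) υ := by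
  obtain ⟨θ', hs, hm⟩ := exists_mem_registerAll (b := b) (k := 𝔸.prio b) (τ := τ) S.control
    (List.mem_map_of_mem (f := fun p : A × Stack => (p.1, 𝔸.prio p.1, p.2))
      (mem_safraBasic.2 ⟨a, ha, hb⟩))
  exact ⟨_, hm, isRegistration_register hs _ _⟩

open Classical in
/-- The annotated states with the priorities that are registered in the third step. -/
noncomputable def epsRequests (𝔸 : EpsParityAutomaton Sig A) (L : List (A × Stack)) :
    List (A × ℕ × Stack) :=
  L.flatMap fun p =>
    (Finset.univ : Finset A).toList.flatMap fun c =>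
      ((List.range ((Finset.univ : Finset A).sup 𝔸.prio + 1)).filter
        (fun k => 𝔸.EpsPath p.1 k c)).map (fun k => (c, k, p.2))

theorem safraEps_eq (𝔸 : EpsParityAutomaton Sig A) (S : State A) (z : Sig) :
    𝔸.safraEps S z =
      ((registerAll (𝔸.safraPrio S z).1 (𝔸.epsRequests (𝔸.safraPrio S z).2)).1,
        (𝔸.safraPrio S z).2 ++
          (registerAll (𝔸.safraPrio S z).1 (𝔸.epsRequests (𝔸.safraPrio S z).2)).2) := rfl

theorem mem_epsRequests {𝔸 : EpsParityAutomaton Sig A} {L : List (A × Stack)} {c : A} {k : ℕ}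
    {σ : Stack} : (c, k, σ) ∈ 𝔸.epsRequests L ↔ ∃ b, (b, σ) ∈ L ∧ 𝔸.EpsPath b k c := by
  simp only [epsRequests, List.mem_flatMap, Finset.mem_toList, Finset.mem_univ, true_and,
    List.mem_map, List.mem_filter, List.mem_range, decide_eq_true_eq, Prod.mk.injEq]
  constructor
  · rintro ⟨⟨b, σ'⟩, hp, c', k', ⟨-, hk⟩, rfl, rfl, rfl⟩
    exact ⟨b, hp, hk⟩
  · rintro ⟨b, hb, hk⟩
    exact ⟨(b, σ), hb, c, k, ⟨Nat.lt_succ_of_le hk.le_sup, hk⟩, rfl, rfl, rfl⟩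

theorem exists_of_mem_safraEps {𝔸 : EpsParityAutomaton Sig A} {S : State A} {z : Sig} {c : A}
    {υ : Stack} (h : (c, υ) ∈ (𝔸.safraEps S z).2) :
    ∃ a τ m, S.stack a = some τ ∧ 𝔸.MacroStep z a m c ∧ IsRegistration S.control τ m υ := by
  rw [safraEps_eq] at h
  rcases List.mem_append.1 h with h | h
  · obtain ⟨a, τ, ha, hb, hr⟩ := exists_of_mem_safraPrio h
    exact ⟨a, τ, _, ha, ⟨c, hb, Or.inl ⟨rfl, rfl⟩⟩, hr⟩
  · obtain ⟨k, σ, θ', hm, hs, rfl⟩ := exists_register_of_mem_registerAll h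
    obtain ⟨b, hb, hk⟩ := mem_epsRequests.1 hm
    obtain ⟨a, τ, ha, hb, hr⟩ := exists_of_mem_safraPrio hb
    exact ⟨a, τ, _, ha, ⟨b, hb, Or.inr ⟨k, hk, rfl⟩⟩, hr.trans (isRegistration_register
      (List.Subset.trans (𝔸.control_subset_safraPrio S z) hs) _ _)⟩

theorem exists_mem_safraEps {𝔸 : EpsParityAutomaton Sig A} {S : State A} {z : Sig} {a c : A}
    {τ : Stack} {m : ℕ} (ha : S.stack a = some τ) (h : 𝔸.MacroStep z a m c) :
    ∃ υ, (c, υ) ∈ (𝔸.safraEps S z).2 ∧ IsRegistration S.control τ m υ := by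
  rw [safraEps_eq]
  obtain ⟨b, hb, ⟨rfl, rfl⟩ | ⟨k, hk, rfl⟩⟩ := h
  · obtain ⟨υ, hm, hr⟩ := exists_mem_safraPrio ha hb
    exact ⟨υ, List.mem_append_left _ hm, hr⟩
  · obtain ⟨σ, hm, hr⟩ := exists_mem_safraPrio ha hb
    obtain ⟨θ', hs, hm'⟩ := exists_mem_registerAll (𝔸.safraPrio S z).1
      (mem_epsRequests.2 ⟨b, hm, hk⟩)
    exact ⟨_, List.mem_append_right _ hm', hr.trans (isRegistration_register
      (List.Subset.trans (𝔸.control_subset_safraPrio S z) hs) _ _)⟩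

theorem coherent_safraEps {𝔸 : EpsParityAutomaton Sig A} {S : State A}
    (h : Coherent S.control (stackSet S.stack)) (z : Sig) :
    Coherent (𝔸.safraEps S z).1 {υ | ∃ b, (b, υ) ∈ (𝔸.safraEps S z).2} := by
  have h1 := h.registerAll (L := (𝔸.safraBasic S z).map fun p => (p.1, 𝔸.prio p.1, p.2)) (by
    intro p hp
    obtain ⟨⟨b, τ⟩, hq, rfl⟩ := List.mem_map.1 hp
    obtain ⟨a, ha, -⟩ := mem_safraBasic.1 hq
    exact ⟨a, ha⟩)
  have h2 := (h1.mono Set.subset_union_right).registerAll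
    (L := 𝔸.epsRequests (𝔸.safraPrio S z).2) (by
      rintro ⟨c, k, σ⟩ hp
      obtain ⟨b, hb, -⟩ := mem_epsRequests.1 hp
      exact ⟨b, hb⟩)
  refine h2.mono ?_
  rintro υ ⟨b, hb⟩
  rw [safraEps_eq] at hb
  rcases List.mem_append.1 hb with hb | hb
  · exact Or.inl ⟨b, hb⟩
  · exact Or.inr ⟨b, hb⟩

theorem coherent_safraThin {𝔸 : EpsParityAutomaton Sig A} {S : State A}
    (h : Coherent S.control (stackSet S.stack)) (z : Sig) :
    Coherent (𝔸.safraEps S z).1 (stackSet (𝔸.safraThin S z)) := by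
  refine (coherent_safraEps h z).mono ?_
  rintro τ ⟨a, ha⟩
  exact ⟨a, (thin_spec ha).1⟩

/-- An upper bound for the number of registrations in a transition. -/
noncomputable def registrationBound (𝔸 : EpsParityAutomaton Sig A) : ℕ :=
  Fintype.card A * Fintype.card A +
    Fintype.card A * Fintype.card A *
      (Fintype.card A * ((Finset.univ : Finset A).sup 𝔸.prio + 1))

theorem length_flatMap_le {α β : Type*} {l : List α} {f : α → List β} {n : ℕ}
    (h : ∀ x ∈ l, (f x).length ≤ n) : (l.flatMap f).length ≤ l.length * n := by
  rw [List.length_flatMap]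
  refine (List.sum_le_card_nsmul _ n ?_).trans (by simp)
  simpa using h

theorem length_safraBasic_le (𝔸 : EpsParityAutomaton Sig A) (S : State A) (z : Sig) :
    (𝔸.safraBasic S z).length ≤ Fintype.card A * Fintype.card A := by
  classical
  refine (List.dedup_sublist _).length_le.trans ?_
  refine (length_flatMap_le (n := Fintype.card A) ?_).trans_eq (by simp)
  intro a _
  split
  · simp
  · rw [List.length_map]
    exact (List.length_filter_le _ _).trans (by simp)

theorem length_epsRequests_le (𝔸 : EpsParityAutomaton Sig A) (L : List (A × Stack)) :
    (𝔸.epsRequests L).length ≤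
      L.length * (Fintype.card A * ((Finset.univ : Finset A).sup 𝔸.prio + 1)) := by
  refine length_flatMap_le fun p _ => ?_
  refine (length_flatMap_le (n := (Finset.univ : Finset A).sup 𝔸.prio + 1) ?_).trans_eq (by simp)
  intro c _
  rw [List.length_map]
  exact (List.length_filter_le _ _).trans (by simp)

theorem mem_control_safraEps {𝔸 : EpsParityAutomaton Sig A} {S : State A} {z : Sig} {x : Name}
    (h : x ∈ (𝔸.safraEps S z).1) :
    x ∈ S.control ∨ Even x.level ∧ x.level ≤ (Finset.univ : Finset A).sup 𝔸.prio ∧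
      x.index ≤ S.control.length + 𝔸.registrationBound := by
  have hb := 𝔸.length_safraBasic_le S z
  have hp : (𝔸.safraPrio S z).2.length = (𝔸.safraBasic S z).length := by
    rw [safraPrio, length_registerAll, List.length_map]
  have hc := length_control_registerAll_le S.control
    ((𝔸.safraBasic S z).map fun p => (p.1, 𝔸.prio p.1, p.2))
  rw [List.length_map] at hc
  have he := (𝔸.length_epsRequests_le (𝔸.safraPrio S z).2).trans
    (Nat.mul_le_mul_right _ (hp.trans_le hb))
  rw [safraEps_eq] at h
  unfold registrationBound
  rcases mem_control_registerAll h with h | ⟨h1, ⟨⟨c, k, σ⟩, h2, h3⟩, h4⟩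
  · rcases mem_control_registerAll h with h | ⟨h1, ⟨p, h2, h3⟩, h4⟩
    · exact Or.inl h
    · obtain ⟨q, -, rfl⟩ := List.mem_map.1 h2
      refine Or.inr ⟨h1, h3 ▸ 𝔸.prio_le_sup q.1, ?_⟩
      rw [List.length_map] at h4
      omega
  · obtain ⟨b, -, hk⟩ := mem_epsRequests.1 h2
    refine Or.inr ⟨h1, h3 ▸ hk.le_sup, ?_⟩
    change (𝔸.safraPrio S z).1.length ≤ _ at hc
    omega

/-! ### Reachable states -/

/-- An upper bound for the number of names in play. -/
noncomputable def playBound (𝔸 : EpsParityAutomaton Sig A) : ℕ :=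
  ((Finset.univ : Finset A).sup 𝔸.prio + 1) * Fintype.card A

/-- The properties of a Safra-state that are preserved by all transitions. -/
structure IsRegular (𝔸 : EpsParityAutomaton Sig A) (S : State A) : Prop where
  coherent : Coherent S.control (stackSet S.stack)
  nodup : S.control.Nodup
  top : ∀ x ∈ S.control, ∃ a ρ σ, S.stack a = some (ρ ++ x :: σ) ∧ ∀ y ∈ σ, y.level ≠ x.level
  even : ∀ x ∈ S.control, Even x.level
  level_le : ∀ x ∈ S.control, x.level ≤ (Finset.univ : Finset A).sup 𝔸.prio
  index_le : ∀ x ∈ S.control, x.index ≤ 𝔸.playBound + 𝔸.registrationBound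
  inPlay_of_green : ∀ x, S.colour x = Colour.green → InPlay S.stack x

namespace IsRegular

theorem mem_control {𝔸 : EpsParityAutomaton Sig A} {S : State A} (h : 𝔸.IsRegular S) {x : Name}
    (hx : InPlay S.stack x) : x ∈ S.control := by
  obtain ⟨a, τ, ha, hx⟩ := hx
  exact h.coherent.mem_control τ ⟨a, ha⟩ x hx

theorem length_control_le {𝔸 : EpsParityAutomaton Sig A} {S : State A} (h : 𝔸.IsRegular S) :
    S.control.length ≤ 𝔸.playBound := by
  classical
  have hA : S.control = [] ∨ Nonempty A := by
    rcases hc : S.control with _ | ⟨x, l⟩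
    · exact Or.inl rfl
    · obtain ⟨a, -⟩ := h.top x (by simp [hc])
      exact Or.inr ⟨a⟩
  rcases hA with hA | hA
  · simp [hA]
  choose! a ρ σ ha hσ using h.top
  rw [← List.toFinset_card_of_nodup h.nodup]
  have : (S.control.toFinset).card ≤
      (Finset.range ((Finset.univ : Finset A).sup 𝔸.prio + 1) ×ˢ (Finset.univ : Finset A)).card := by
    refine Finset.card_le_card_of_injOn (fun x => (x.level, a x)) ?_ ?_
    · intro x hx
      have hx : x ∈ S.control := by simpa using hx
      simpa [Nat.lt_succ_iff] using h.level_le x hx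
    · intro x hx y hy hxy
      have hx : x ∈ S.control := by simpa using hx
      have hy : y ∈ S.control := by simpa using hy
      simp only [Prod.mk.injEq] at hxy
      have hay := ha y hy
      rw [← hxy.2, ha x hx, Option.some.injEq] at hay
      exact eq_of_top rfl hay (hσ x hx) (hσ y hy) hxy.1
  simpa [playBound] using this

theorem init (𝔸 : EpsParityAutomaton Sig A) : 𝔸.IsRegular 𝔸.safra.init := by
  have hs : ∀ τ ∈ stackSet 𝔸.safra.init.stack, τ = [] := by
    rintro τ ⟨a, ha⟩
    simp only [safra] at ha
    split_ifs at ha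
    simpa using ha.symm
  refine ⟨⟨?_, ?_, ?_⟩, List.nodup_nil, ?_, ?_, ?_, ?_, ?_⟩
  · intro τ hτ
    simp [hs τ hτ]
  · intro τ hτ
    simp [hs τ hτ]
  · intro τ hτ τ' _ x ρ σ ρ' σ' e
    simp [hs τ hτ] at e
  all_goals simp [safra]

theorem next {𝔸 : EpsParityAutomaton Sig A} {S : State A} (h : 𝔸.IsRegular S) (z : Sig) :
    𝔸.IsRegular (𝔸.safraNext S z) := by
  classical
  have hthin := coherent_safraThin (𝔸 := 𝔸) h.coherent z
  have hprefix : ∀ τ' ∈ stackSet (reset (𝔸.safraThin S z)),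
      ∃ τ ∈ stackSet (𝔸.safraThin S z), τ' <+: τ := by
    rintro τ' ⟨a, ha⟩
    obtain ⟨τ, hτ, rfl⟩ := Option.map_eq_some_iff.1 ha
    exact ⟨τ, ⟨a, hτ⟩, cut_prefix _ _⟩
  have hreset := hthin.of_prefix hprefix
  have hmem : ∀ x, x ∈ (𝔸.safraNext S z).control ↔
      x ∈ (𝔸.safraEps S z).1 ∧ InPlay (reset (𝔸.safraThin S z)) x := by
    intro x
    simp [safraNext]
  have hnew : ∀ x ∈ (𝔸.safraNext S z).control, Even x.level ∧
      x.level ≤ (Finset.univ : Finset A).sup 𝔸.prio ∧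
      x.index ≤ 𝔸.playBound + 𝔸.registrationBound := by
    intro x hx
    rcases mem_control_safraEps ((hmem x).1 hx).1 with hx | ⟨h1, h2, h3⟩
    · exact ⟨h.even x hx, h.level_le x hx, h.index_le x hx⟩
    · exact ⟨h1, h2, h3.trans (Nat.add_le_add_right h.length_control_le _)⟩
  refine ⟨⟨?_, hreset.sorted, hreset.below⟩, ?_, ?_, fun x hx => (hnew x hx).1,
    fun x hx => (hnew x hx).2.1, fun x hx => (hnew x hx).2.2, ?_⟩
  · rintro τ ⟨a, ha⟩ x hx
    exact (hmem x).2 ⟨hreset.mem_control τ ⟨a, ha⟩ x hx, a, τ, ha, hx⟩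
  · exact (nodup_control_registerAll (nodup_control_registerAll h.nodup _) _).filter _
  · intro x hx
    exact exists_top_of_inPlay_reset hthin ((hmem x).1 hx).2
  · intro x hx
    by_contra hcon
    have : ¬ InPlay (reset (𝔸.safraThin S z)) x := hcon
    simp [safraNext, this] at hx

theorem of_reachable {𝔸 : EpsParityAutomaton Sig A} {S : State A} (h : 𝔸.safra.Reachable S) :
    𝔸.IsRegular S := by
  induction h with
  | init => exact init 𝔸
  | next S z _ ih => exact ih.next z

theorem length_stack_le {𝔸 : EpsParityAutomaton Sig A} {S : State A} (h : 𝔸.IsRegular S)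
    {τ : Stack} (hτ : τ ∈ stackSet S.stack) : τ.length ≤ 𝔸.playBound := by
  have hnd : τ.Nodup := by
    by_contra hcon
    obtain ⟨x, hx⟩ := List.exists_duplicate_iff_not_nodup.2 hcon
    obtain ⟨ρ, r, rfl, hr⟩ : ∃ ρ r, τ = ρ ++ x :: r ∧ x ∈ r := by
      clear hτ hcon
      induction hx with
      | cons_mem hx => exact ⟨[], _, rfl, hx⟩
      | cons_duplicate _ ih =>
        rename_i y l _
        obtain ⟨ρ, r, rfl, hr⟩ := ih
        exact ⟨y :: ρ, r, rfl, hr⟩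
    obtain ⟨r₁, r₂, rfl⟩ := List.append_of_mem hr
    have := h.coherent.below _ hτ _ hτ x ρ _ (ρ ++ x :: r₁) r₂ rfl (by simp)
    simpa using congrArg List.length this
  exact (hnd.subperm (h.coherent.mem_control τ hτ)).length_le.trans h.length_control_le

end IsRegular

theorem finite_lists {α : Type*} {s : Set α} (hs : s.Finite) (n : ℕ) :
    {l : List α | (∀ x ∈ l, x ∈ s) ∧ l.length ≤ n}.Finite := by
  have : Finite s := hs
  refine ((List.finite_length_le s n).image (List.map Subtype.val)).subset ?_
  rintro l ⟨hl, hn⟩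
  lift l to List s using hl
  exact ⟨l, by simpa using hn, rfl⟩

theorem finite_reachable (𝔸 : EpsParityAutomaton Sig A) :
    {S : State A | 𝔸.safra.Reachable S}.Finite := by
  let N : Set Name := {x | x.level ≤ (Finset.univ : Finset A).sup 𝔸.prio ∧
    x.index ≤ 𝔸.playBound + 𝔸.registrationBound}
  have hN : N.Finite := by
    refine Set.Finite.of_finite_image (f := fun x : Name => (x.level, x.index))
      (((Set.finite_Iic ((Finset.univ : Finset A).sup 𝔸.prio)).prod
        (Set.finite_Iic (𝔸.playBound + 𝔸.registrationBound))).subset ?_) ?_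
    · rintro _ ⟨x, hx, rfl⟩
      exact hx
    · intro x _ y _ hxy
      simp only [Prod.mk.injEq] at hxy
      exact Name.ext hxy.1 hxy.2
  let W : Set Stack := {τ | (∀ x ∈ τ, x ∈ N) ∧ τ.length ≤ 𝔸.playBound}
  have hW : W.Finite := finite_lists hN _
  have hF : {f : A → Option Stack | ∀ a, f a ∈ insert none (some '' W)}.Finite :=
    Set.Finite.pi' fun _ => (hW.image _).insert _
  refine Set.Finite.of_finite_image
    (f := fun S : State A => (S.stack, S.control, {x | S.colour x = Colour.green}))
    ((hF.prod (hW.prod hN.finite_subsets)).subset ?_) ?_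
  · rintro _ ⟨S, hS, rfl⟩
    have hR := IsRegular.of_reachable hS
    have hc : ∀ x ∈ S.control, x ∈ N := fun x hx => ⟨hR.level_le x hx, hR.index_le x hx⟩
    refine ⟨fun a => ?_, ⟨hc, hR.length_control_le⟩, fun x hx =>
      hc x (hR.mem_control (hR.inPlay_of_green x hx))⟩
    rcases ha : S.stack a with _ | τ
    · exact Or.inl ha
    · refine Or.inr ⟨τ, ⟨fun x hx => hc x (hR.coherent.mem_control τ ⟨a, ha⟩ x hx),
        hR.length_stack_le ⟨a, ha⟩⟩, ha.symm⟩
  · intro S _ S' _ h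
    simp only [Prod.mk.injEq, Set.ext_iff, Set.mem_ofPred_eq] at h
    refine State.ext h.1 h.2.1 (funext fun x => ?_)
    have := h.2.2 x
    cases hx : S.colour x <;> cases hx' : S'.colour x <;> simp_all

end EpsParityAutomaton

open Filter in
/-- Kőnig's lemma: if every element of a level has a predecessor in the previous level, and all
levels are nonempty subsets of a finite type, then there is an infinite path. -/
theorem exists_path_of_levels {A : Type*} [Finite A] (V : ℕ → Set A) (R : ℕ → A → A → Prop)
    (hV : ∀ j, (V j).Nonempty) (hR : ∀ j, ∀ c ∈ V (j + 1), ∃ a ∈ V j, R j a c) :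
    ∃ s : ℕ → A, (∀ j, s j ∈ V j) ∧ ∀ j, R j (s j) (s (j + 1)) := by
  let _ : TopologicalSpace A := ⊥
  have : DiscreteTopology A := ⟨rfl⟩
  let C : ℕ → Set (ℕ → A) := fun n =>
    {s | (∀ j ≤ n, s j ∈ V j) ∧ ∀ j < n, R j (s j) (s (j + 1))}
  have hclosed : ∀ n, IsClosed (C n) := by
    intro n
    have h1 : ∀ j, IsClosed {s : ℕ → A | j ≤ n → s j ∈ V j} := fun j =>
      (isClosed_discrete {a : A | j ≤ n → a ∈ V j}).preimage (f := fun s : ℕ → A => s j)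
        (continuous_apply j)
    have h2 : ∀ j, IsClosed {s : ℕ → A | j < n → R j (s j) (s (j + 1))} := fun j =>
      (isClosed_discrete {p : A × A | j < n → R j p.1 p.2}).preimage
        (f := fun s : ℕ → A => (s j, s (j + 1)))
        ((continuous_apply j).prodMk (continuous_apply (j + 1)))
    convert! (isClosed_iInter h1).inter (isClosed_iInter h2) using 1
    ext s
    simp [C]
  have hne : ∀ n, (C n).Nonempty := by
    have key : ∀ n, ∀ c ∈ V n, ∃ s ∈ C n, s n = c := by
      intro n
      induction n with
      | zero =>
        intro c hc
        refine ⟨fun _ => c, ⟨fun j hj => ?_, fun j hj => absurd hj (Nat.not_lt_zero j)⟩, rfl⟩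
        obtain rfl : j = 0 := by omega
        exact hc
      | succ n ih =>
        intro c hc
        obtain ⟨a, ha, hac⟩ := hR n c hc
        obtain ⟨s, ⟨hs1, hs2⟩, rfl⟩ := ih a ha
        refine ⟨fun i => if i ≤ n then s i else c, ⟨fun j hj => ?_, fun j hj => ?_⟩, by simp⟩
        · rcases Nat.lt_or_ge n j with h | h
          · obtain rfl : j = n + 1 := by omega
            simpa using hc
          · simpa [h] using hs1 j h
        · rcases Nat.lt_or_ge j n with h | h
          · simpa [h.le, Nat.succ_le_of_lt h] using hs2 j h
          · obtain rfl : j = n := by omega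
            simpa using hac
    intro n
    obtain ⟨c, hc⟩ := hV n
    obtain ⟨s, hs, -⟩ := key n c hc
    exact ⟨s, hs⟩
  obtain ⟨s, hs⟩ := IsCompact.nonempty_iInter_of_sequence_nonempty_isCompact_isClosed C
    (fun n s hs => ⟨fun j hj => hs.1 j (hj.trans n.le_succ),
      fun j hj => hs.2 j (hj.trans n.lt_succ_self)⟩) hne (hclosed 0).isCompact hclosed
  rw [Set.mem_iInter] at hs
  exact ⟨s, fun j => (hs j).1 j le_rfl, fun j => (hs (j + 1)).2 j j.lt_succ_self⟩

namespace EpsParityAutomaton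

variable {Sig A : Type*}

/-! ### Runs in terms of macro steps -/

/-- The sequence of states `s` passes from letter to letter by macro steps with maximal
priorities `m`. -/
structure IsMacroRun (𝔸 : EpsParityAutomaton Sig A) (w : ℕ → Sig) (s : ℕ → A) (m : ℕ → ℕ) :
    Prop where
  init : s 0 = 𝔸.init
  step : ∀ j, 𝔸.MacroStep (w j) (s j) (m j) (s (j + 1))

/-- The parity condition for sequences of priorities. -/
def ParityCondition (m : ℕ → ℕ) : Prop :=
  ∃ k, Even k ∧ (∃ᶠ j in Filter.atTop, m j = k) ∧ ∀ᶠ j in Filter.atTop, m j ≤ k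

/-- A path of length `L` of `ε`-transitions whose states have maximal priority `m`. -/
structure IsEpsSegment (𝔸 : EpsParityAutomaton Sig A) (p : ℕ → A) (L m : ℕ) : Prop where
  step : ∀ r < L, p (r + 1) ∈ 𝔸.eps (p r)
  le : ∀ r ≤ L, 𝔸.prio (p r) ≤ m
  eq : ∃ r ≤ L, 𝔸.prio (p r) = m

theorem isEpsSegment_zero (𝔸 : EpsParityAutomaton Sig A) (a : A) :
    𝔸.IsEpsSegment (fun _ => a) 0 (𝔸.prio a) :=
  ⟨by simp, by simp, ⟨0, le_rfl, rfl⟩⟩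

theorem IsEpsSegment.snoc {𝔸 : EpsParityAutomaton Sig A} {p : ℕ → A} {L m : ℕ}
    (h : 𝔸.IsEpsSegment p L m) {d : A} (hd : d ∈ 𝔸.eps (p L)) :
    𝔸.IsEpsSegment (fun r => if r ≤ L then p r else d) (L + 1) (max m (𝔸.prio d)) := by
  refine ⟨fun r hr => ?_, fun r hr => ?_, ?_⟩
  · rcases Nat.lt_or_ge r L with hrL | hrL
    · simpa [hrL.le, Nat.succ_le_of_lt hrL] using h.step r hrL
    · obtain rfl : r = L := by omega
      simpa using hd
  · by_cases hrL : r ≤ L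
    · simpa [hrL] using Or.inl (h.le r hrL)
    · simp [hrL]
  · obtain ⟨r, hr, he⟩ := h.eq
    rcases le_total m (𝔸.prio d) with hm | hm
    · exact ⟨L + 1, le_rfl, by simp [hm]⟩
    · exact ⟨r, hr.trans L.le_succ, by simp [hr, he, hm]⟩

theorem EpsPath.exists_segment {𝔸 : EpsParityAutomaton Sig A} {b c : A} {k : ℕ}
    (h : 𝔸.EpsPath b k c) :
    ∃ p L, p 0 = b ∧ p L = c ∧ 𝔸.IsEpsSegment p L (max (𝔸.prio b) k) := by
  induction h with
  | single c hc =>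
    exact ⟨_, _, by simp, by simp, (𝔸.isEpsSegment_zero b).snoc hc⟩
  | snoc k c d _ hd ih =>
    obtain ⟨p, L, h0, hL, hs⟩ := ih
    rw [← max_assoc]
    exact ⟨_, _, by simpa using h0, by simp, hs.snoc (hL ▸ hd)⟩

theorem MacroStep.exists_segment {𝔸 : EpsParityAutomaton Sig A} {z : Sig} {a c : A} {m : ℕ}
    (h : 𝔸.MacroStep z a m c) :
    ∃ p L, p 0 ∈ 𝔸.basic a z ∧ p L = c ∧ 𝔸.IsEpsSegment p L m := by
  obtain ⟨b, hb, ⟨rfl, rfl⟩ | ⟨k, hk, rfl⟩⟩ := h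
  · exact ⟨_, _, hb, rfl, 𝔸.isEpsSegment_zero c⟩
  · obtain ⟨p, L, rfl, hL, hs⟩ := hk.exists_segment
    exact ⟨p, L, hb, hL, hs⟩

theorem macroStep_of_path {𝔸 : EpsParityAutomaton Sig A} {z : Sig} {a : A} {p : ℕ → A} {L : ℕ}
    (h0 : p 0 ∈ 𝔸.basic a z) (hs : ∀ r < L, p (r + 1) ∈ 𝔸.eps (p r)) :
    𝔸.MacroStep z a ((Finset.range (L + 1)).sup fun r => 𝔸.prio (p r)) (p L) := by
  refine ⟨p 0, h0, ?_⟩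
  induction L with
  | zero => exact Or.inl ⟨by simp, rfl⟩
  | succ L ih =>
    right
    have hd := hs L L.lt_succ_self
    rw [Finset.range_add_one, Finset.sup_insert, sup_comm]
    rcases ih fun r hr => hs r (hr.trans L.lt_succ_self) with ⟨hm, hL⟩ | ⟨k, hk, hm⟩
    · rw [hm]
      exact ⟨_, EpsPath.single _ (hL ▸ hd), rfl⟩
    · rw [hm]
      exact ⟨_, EpsPath.snoc _ _ _ hk hd, by rw [max_assoc]⟩

theorem IsMacroRun.mem_language {𝔸 : EpsParityAutomaton Sig A} {w : ℕ → Sig} {s : ℕ → A}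
    {m : ℕ → ℕ} (h : 𝔸.IsMacroRun w s m) (hm : ParityCondition m) : w ∈ 𝔸.language := by
  choose p L hp hL hs using fun j => (h.step j).exists_segment
  let P : ℕ → ℕ → A := fun j => Nat.casesOn (motive := fun _ => ℕ → A) j (fun _ => 𝔸.init) p
  let l : ℕ → ℕ := fun j => Nat.casesOn (motive := fun _ => ℕ) j 0 L
  have hPs : ∀ j, P j (l j) = s j := by
    rintro (_ | j)
    · exact h.init.symm
    · exact hL j
  have hPb : ∀ j, P (j + 1) 0 ∈ 𝔸.basic (P j (l j)) (w j) := fun j => by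
    rw [hPs]
    exact hp j
  have hPe : ∀ j, ∀ r < l j, P j (r + 1) ∈ 𝔸.eps (P j r) := by
    rintro (_ | j) r hr
    · exact absurd hr (Nat.not_lt_zero r)
    · exact (hs j).step r hr
  let c : ℕ → ℕ × ℕ := fun i => Nat.rec (motive := fun _ => ℕ × ℕ) (0, 0)
    (fun (_ : ℕ) (q : ℕ × ℕ) => if q.2 < l q.1 then (q.1, q.2 + 1) else (q.1 + 1, 0)) i
  have hc : ∀ i, c (i + 1) =
      if (c i).2 < l (c i).1 then ((c i).1, (c i).2 + 1) else ((c i).1 + 1, 0) := fun _ => rfl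
  have hcl : ∀ i, (c i).2 ≤ l (c i).1 := by
    intro i
    induction i with
    | zero => exact Nat.zero_le _
    | succ i ih =>
      rw [hc]
      split_ifs with hi
      · exact hi
      · exact Nat.zero_le _
  have hreach : ∀ j, ∀ r ≤ l j, ∃ i, c i = (j, r) := by
    have inner : ∀ j, (∃ i, c i = (j, 0)) → ∀ r ≤ l j, ∃ i, c i = (j, r) := by
      intro j h0 r
      induction r with
      | zero => exact fun _ => h0
      | succ r ih =>
        intro hr
        obtain ⟨i, hi⟩ := ih (by omega)
        refine ⟨i + 1, ?_⟩
        rw [hc, hi]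
        exact if_pos hr
    intro j
    induction j with
    | zero => exact inner 0 ⟨0, rfl⟩
    | succ j ih =>
      refine inner (j + 1) ?_
      obtain ⟨i, hi⟩ := ih (l j) le_rfl
      refine ⟨i + 1, ?_⟩
      rw [hc, hi]
      exact if_neg (lt_irrefl _)
  have hle : ∀ i, (c i).1 ≤ i := by
    intro i
    induction i with
    | zero => exact le_rfl
    | succ i ih =>
      rw [hc]
      split_ifs
      · exact ih.trans i.le_succ
      · exact Nat.succ_le_succ ih
  have hmono : Monotone fun i => (c i).1 := by
    refine monotone_nat_of_le_succ fun i => ?_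
    change (c i).1 ≤ (c (i + 1)).1
    rw [hc]
    split_ifs
    · exact le_rfl
    · exact Nat.le_succ _
  refine ⟨fun i => P (c i).1 (c i).2, fun i => (c i).1, ⟨rfl, rfl, fun i => ?_, fun j => ?_⟩, ?_⟩
  · simp only [hc]
    split_ifs with hi
    · exact Or.inr ⟨hPe _ _ hi, rfl⟩
    · have : (c i).2 = l (c i).1 := le_antisymm (hcl i) (not_lt.1 hi)
      refine Or.inl ⟨?_, rfl⟩
      rw [this]
      exact hPb _
  · obtain ⟨i, hi⟩ := hreach j 0 (Nat.zero_le _)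
    exact ⟨i, by simp [hi]⟩
  · obtain ⟨k, hk, hf, he⟩ := hm
    refine ⟨k, hk, ?_, ?_⟩
    · rw [Filter.frequently_atTop] at hf ⊢
      intro N
      obtain ⟨j, hj, hjk⟩ := hf N
      obtain ⟨r, hr, hrk⟩ := (hs j).eq
      obtain ⟨i, hi⟩ := hreach (j + 1) r hr
      refine ⟨i, ?_, ?_⟩
      · have := hle i
        rw [hi] at this
        exact hj.trans (j.le_succ.trans this)
      · change 𝔸.prio (P (c i).1 (c i).2) = k
        rw [hi, ← hjk]
        exact hrk
    · rw [Filter.eventually_atTop] at he ⊢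
      obtain ⟨N, hN⟩ := he
      obtain ⟨i₀, hi₀⟩ := hreach (N + 1) 0 (Nat.zero_le _)
      refine ⟨i₀, fun i hi => ?_⟩
      have h1 : N + 1 ≤ (c i).1 := by
        have := hmono hi
        simpa [hi₀] using this
      obtain ⟨j, hj⟩ : ∃ j, (c i).1 = j + 1 := ⟨(c i).1 - 1, by omega⟩
      have h2 := hcl i
      change 𝔸.prio (P (c i).1 (c i).2) ≤ k
      rw [hj] at h2 ⊢
      exact ((hs j).le _ h2).trans (hN j (by omega))

theorem exists_isMacroRun {𝔸 : EpsParityAutomaton Sig A} (hinit : 𝔸.eps 𝔸.init = ∅)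
    {w : ℕ → Sig} (hw : w ∈ 𝔸.language) : ∃ s m, 𝔸.IsMacroRun w s m ∧ ParityCondition m := by
  obtain ⟨a, n, hrun, k, hk, hf, he⟩ := hw
  have hstep : ∀ i, n (i + 1) = n i + 1 ∨ n (i + 1) = n i := fun i =>
    (hrun.step i).imp And.right And.right
  have hmono : Monotone n := monotone_nat_of_le_succ fun i => by
    rcases hstep i with h | h <;> omega
  have hle : ∀ i, n i ≤ i := by
    intro i
    induction i with
    | zero => exact hrun.pos_zero.le
    | succ i ih => rcases hstep i with h | h <;> omega
  let F : ℕ → ℕ := fun j => Nat.find (hrun.reads_all j)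
  have hF : ∀ j i, F j ≤ i ↔ j ≤ n i := fun j i =>
    ⟨fun h => (Nat.find_spec (hrun.reads_all j)).trans (hmono h), fun h => Nat.find_min' _ h⟩
  have hFlt : ∀ j i, i < F j ↔ n i < j := fun j i => by
    rw [← not_le, hF, not_le]
  have hpos : ∀ j, 1 ≤ F (j + 1) := fun j => by
    rw [Nat.one_le_iff_ne_zero, ← Nat.pos_iff_ne_zero, hFlt, hrun.pos_zero]
    exact j.succ_pos
  have hpred : ∀ j, n (F (j + 1) - 1) = j ∧ n (F (j + 1)) = j + 1 := by
    intro j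
    have h1 := (hFlt (j + 1) (F (j + 1) - 1)).1 (by have := hpos j; omega)
    have h2 := (hF (j + 1) (F (j + 1))).1 le_rfl
    have h3 := hstep (F (j + 1) - 1)
    rw [Nat.sub_add_cancel (hpos j)] at h3
    omega
  have hlt : ∀ j, F (j + 1) < F (j + 2) := fun j => by
    rw [hFlt, (hpred j).2]
    omega
  have hbasic : ∀ j, a (F (j + 1)) ∈ 𝔸.basic (a (F (j + 1) - 1)) (w j) := by
    intro j
    have h := hrun.step (F (j + 1) - 1)
    rw [Nat.sub_add_cancel (hpos j), (hpred j).1, (hpred j).2] at h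
    rcases h with h | h
    · exact h.1
    · omega
  have heps : ∀ j, ∀ r < F (j + 2) - 1 - F (j + 1),
      a (F (j + 1) + (r + 1)) ∈ 𝔸.eps (a (F (j + 1) + r)) := by
    intro j r hr
    have h1 := (hF (j + 1) (F (j + 1) + r)).1 (Nat.le_add_right _ _)
    have h2 := (hFlt (j + 2) (F (j + 1) + (r + 1))).1 (by omega)
    rcases hrun.step (F (j + 1) + r) with h | h
    · rw [← add_assoc] at h2
      omega
    · exact h.1
  let m : ℕ → ℕ := fun j =>
    (Finset.range (F (j + 2) - 1 - F (j + 1) + 1)).sup fun r => 𝔸.prio (a (F (j + 1) + r))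
  refine ⟨fun j => a (F (j + 1) - 1), m, ⟨?_, fun j => ?_⟩, k, hk, ?_⟩
  · have hone : n 1 = 1 := by
      rcases hrun.step 0 with h | h
      · simpa [hrun.pos_zero] using h.2
      · rw [hrun.state_zero, hinit] at h
        exact absurd h.1 (Set.notMem_empty _)
    have h1 := (hF (0 + 1) 1).2 hone.ge
    have h2 := hpos 0
    have h3 : F (0 + 1) - 1 = 0 := by omega
    simp only [h3]
    exact hrun.state_zero
  · have h := macroStep_of_path (𝔸 := 𝔸) (p := fun r => a (F (j + 1) + r)) (hbasic j) (heps j)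
    have hlast : F (j + 1) + (F (j + 2) - 1 - F (j + 1)) = F (j + 1 + 1) - 1 := by
      have := hlt j
      change _ = F (j + 2) - 1
      omega
    simp only [hlast] at h
    exact h
  · have hmle : ∀ᶠ j in Filter.atTop, m j ≤ k := by
      rw [Filter.eventually_atTop] at he ⊢
      obtain ⟨N, hN⟩ := he
      refine ⟨N, fun j hj => Finset.sup_le fun r _ => hN _ ?_⟩
      have h1 := hle (F (j + 1))
      rw [(hpred j).2] at h1
      omega
    refine ⟨?_, hmle⟩
    suffices h : ∃ᶠ j in Filter.atTop, k ≤ m j from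
      (h.and_eventually hmle).mono fun j hj => le_antisymm hj.2 hj.1
    rw [Filter.frequently_atTop] at hf ⊢
    intro N
    obtain ⟨i, hi, hik⟩ := hf (F (N + 1))
    have h1 := (hF (N + 1) i).1 hi
    obtain ⟨j, hj⟩ : ∃ j, n i = j + 1 := ⟨n i - 1, by omega⟩
    have h2 := (hF (j + 1) i).2 hj.ge
    have h3 := (hFlt (j + 2) i).2 (by omega)
    refine ⟨j, by omega, ?_⟩
    rw [← hik]
    have h4 : F (j + 1) + (i - F (j + 1)) = i := by omega
    have := Finset.le_sup (f := fun r => 𝔸.prio (a (F (j + 1) + r)))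
      (Finset.mem_range.2 (show i - F (j + 1) < F (j + 2) - 1 - F (j + 1) + 1 by omega))
    simp only [h4] at this
    exact this

end EpsParityAutomaton

namespace Safra

/-- No occurrence of `x` in `τ` has a name of the same level above it. -/
def IsTop (x : Name) (τ : Stack) : Prop :=
  ∀ ρ σ, τ = ρ ++ x :: σ → ∀ y ∈ σ, y.level ≠ x.level

theorem IsTop.of_prefix {x : Name} {τ τ' : Stack} (h : IsTop x τ) (hp : τ' <+: τ) :
    IsTop x τ' := by
  obtain ⟨r, rfl⟩ := hp
  rintro ρ σ rfl y hy
  exact h ρ (σ ++ r) (by simp) y (List.mem_append_left _ hy)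

theorem isTop_cut {P : Name → Prop} {x : Name} (hx : P x) (τ : Stack) : IsTop x (cut P τ) := by
  intro ρ σ h
  simp [(cut_eq_split h).2 hx]

namespace IsRegistration

theorem mem_of_mem {θ : Control} {τ υ : Stack} {m : ℕ} (h : IsRegistration θ τ m υ) {x : Name}
    (hθ : x ∈ θ) (hx : x ∈ υ) : x ∈ τ ∧ m ≤ x.level := by
  obtain ⟨ν, rfl, hν, -⟩ := h
  rcases List.mem_append.1 hx with hx | hx
  · exact ⟨List.mem_of_mem_filter hx, of_decide_eq_true (List.mem_filter.1 hx).2⟩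
  · exact absurd hθ (hν x hx).1

theorem isTop {θ : Control} {τ υ : Stack} {m : ℕ} (h : IsRegistration θ τ m υ) {x : Name}
    (hθ : x ∈ θ) (hm : m < x.level) (hx : IsTop x τ) : IsTop x υ := by
  obtain ⟨ν, rfl, hν, -⟩ := h
  intro ρ σ he y hy
  have hxν : x ∉ ν := fun hx => (hν x hx).1 hθ
  rcases List.append_eq_append_iff.1 he with ⟨a, -, ha⟩ | ⟨a, ha', ha⟩
  · exact absurd (by simp [ha]) hxν
  · rcases a with _ | ⟨z, a⟩
    · rw [List.nil_append] at ha
      exact absurd (by simp [← ha]) hxν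
    · simp only [List.cons_append, List.cons.injEq] at ha
      obtain ⟨rfl, rfl⟩ := ha
      obtain ⟨τ₁, τ₂, rfl, -, h₂⟩ := List.filter_eq_append_iff.1 ha'
      obtain ⟨τ₃, τ₄, rfl, -, -, h₄⟩ := List.filter_eq_cons_iff.1 h₂
      rcases List.mem_append.1 hy with hy | hy
      · rw [← h₄] at hy
        exact hx (τ₁ ++ τ₃) τ₄ (by simp) y (List.mem_of_mem_filter hy)
      · have := (hν y hy).2
        omega

end IsRegistration

end Safra

namespace EpsParityAutomaton

open Safra

variable {Sig A : Type*} [Fintype A]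

theorem exists_of_safraNext {𝔸 : EpsParityAutomaton Sig A} {S : State A} {z : Sig} {c : A}
    {τ' : Stack} (h : (𝔸.safraNext S z).stack c = some τ') :
    ∃ a τ m υ, S.stack a = some τ ∧ 𝔸.MacroStep z a m c ∧ IsRegistration S.control τ m υ ∧
      𝔸.safraThin S z c = some υ ∧ τ' = cut (Invisible (𝔸.safraThin S z)) υ := by
  obtain ⟨υ, hυ, rfl⟩ := Option.map_eq_some_iff.1 h
  obtain ⟨a, τ, m, ha, hm, hr⟩ := exists_of_mem_safraEps (thin_spec hυ).1
  exact ⟨a, τ, m, υ, ha, hm, hr, hυ, rfl⟩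

theorem green_iff {𝔸 : EpsParityAutomaton Sig A} {S : State A} {z : Sig} {x : Name} :
    (𝔸.safraNext S z).colour x = Colour.green ↔
      Invisible (𝔸.safraThin S z) x ∧ InPlay (𝔸.safraNext S z).stack x := by
  simp only [safraNext]
  split_ifs with h <;> simp [h]

theorem reachable_run (𝔸 : EpsParityAutomaton Sig A) (w : ℕ → Sig) (j : ℕ) :
    𝔸.safra.Reachable (𝔸.safra.run w j) := by
  induction j with
  | zero => exact .init
  | succ j ih => exact .next _ _ ih

theorem isRegular_run (𝔸 : EpsParityAutomaton Sig A) (w : ℕ → Sig) (j : ℕ) :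
    𝔸.IsRegular (𝔸.safra.run w j) :=
  .of_reachable (𝔸.reachable_run w j)

/-- A state whose stack contains a name that was in play before has a predecessor whose stack
contains this name. -/
theorem exists_pred_of_mem {𝔸 : EpsParityAutomaton Sig A} {S : State A} (hS : 𝔸.IsRegular S)
    {z : Sig} {x : Name} (hx : InPlay S.stack x) {c : A} {τ' : Stack}
    (hc : (𝔸.safraNext S z).stack c = some τ') (hxτ : x ∈ τ') :
    ∃ a τ m, S.stack a = some τ ∧ x ∈ τ ∧ 𝔸.MacroStep z a m c ∧ m ≤ x.level ∧
      (IsTop x τ → m < x.level →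
        IsTop x τ' ∧ (𝔸.safraNext S z).colour x ≠ Colour.green) := by
  obtain ⟨a, τ, m, υ, ha, hm, hr, hυ, rfl⟩ := exists_of_safraNext hc
  have hθ := hS.mem_control hx
  have hp := cut_prefix (Invisible (𝔸.safraThin S z)) υ
  have hxυ := hp.subset hxτ
  obtain ⟨hxτ', hml⟩ := hr.mem_of_mem hθ hxυ
  refine ⟨a, τ, m, ha, hxτ', hm, hml, fun ht hlt => ?_⟩
  have htop := hr.isTop hθ hlt ht
  refine ⟨htop.of_prefix hp, fun hg => ?_⟩
  obtain ⟨ρ, σ, rfl⟩ := List.append_of_mem hxυ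
  obtain ⟨y, hy, hyl⟩ := (green_iff.1 hg).1.2 c ρ σ hυ
  exact htop ρ σ rfl y hy hyl

theorem isTop_of_green {𝔸 : EpsParityAutomaton Sig A} {S : State A} {z : Sig} {x : Name}
    (hg : (𝔸.safraNext S z).colour x = Colour.green) {c : A} {τ : Stack}
    (hc : (𝔸.safraNext S z).stack c = some τ) : IsTop x τ := by
  obtain ⟨υ, -, rfl⟩ := Option.map_eq_some_iff.1 hc
  exact isTop_cut (green_iff.1 hg).1 υ

theorem safra_language_subset (𝔸 : EpsParityAutomaton Sig A) :
    𝔸.safra.language ⊆ 𝔸.language := by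
  rintro w ⟨x, hact, hgreen⟩
  rw [Filter.eventually_atTop] at hact
  rw [Filter.frequently_atTop] at hgreen
  obtain ⟨J, hJ⟩ := hact
  let ρ := 𝔸.safra.run w
  have hreg : ∀ j, 𝔸.IsRegular (ρ j) := 𝔸.isRegular_run w
  have hplay : ∀ j ≥ J, InPlay (ρ j).stack x := hJ
  have hgr : ∀ n, ∃ j ≥ n, (ρ j).colour x = Colour.green := hgreen
  have hnext : ∀ j, ρ (j + 1) = 𝔸.safraNext (ρ j) (w j) := fun _ => rfl
  let V : ℕ → Set A := fun j => {a | ∃ τ, (ρ j).stack a = some τ ∧ (J ≤ j → x ∈ τ)}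
  let T : ℕ → A → Prop := fun j a => ∀ τ, (ρ j).stack a = some τ → IsTop x τ
  let R : ℕ → A → A → Prop := fun j a c => ∃ m, 𝔸.MacroStep (w j) a m c ∧
    (J ≤ j → m ≤ x.level ∧ (T j a → m < x.level →
      T (j + 1) c ∧ (ρ (j + 1)).colour x ≠ Colour.green))
  have hR : ∀ j, ∀ c ∈ V (j + 1), ∃ a ∈ V j, R j a c := by
    rintro j c ⟨τ', hc, hx⟩
    rcases Nat.lt_or_ge j J with hj | hj
    · obtain ⟨a, τ, m, υ, ha, hm, -⟩ := exists_of_safraNext hc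
      exact ⟨a, ⟨τ, ha, fun h => by omega⟩, m, hm, fun h => by omega⟩
    · obtain ⟨a, τ, m, ha, hxτ, hm, hml, ht⟩ :=
        exists_pred_of_mem (hreg j) (hplay j hj) hc (hx (by omega))
      refine ⟨a, ⟨τ, ha, fun _ => hxτ⟩, m, hm, fun _ => ⟨hml, fun hT hlt => ?_⟩⟩
      obtain ⟨h1, h2⟩ := ht (hT τ ha) hlt
      refine ⟨fun τ₂ hτ₂ => ?_, h2⟩
      have : τ' = τ₂ := Option.some.inj (hc.symm.trans hτ₂)
      exact this ▸ h1
  have hVJ : ∀ j ≥ J, (V j).Nonempty := fun j hj => by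
    obtain ⟨a, τ, ha, hx⟩ := hplay j hj
    exact ⟨a, τ, ha, fun _ => hx⟩
  have hV : ∀ j, (V j).Nonempty := by
    have hdown : ∀ d j, j + d = J → (V j).Nonempty := by
      intro d
      induction d with
      | zero => exact fun j hj => hVJ j (by omega)
      | succ d ih =>
        intro j hj
        obtain ⟨c, hc⟩ := ih (j + 1) (by omega)
        obtain ⟨a, ha, -⟩ := hR j c hc
        exact ⟨a, ha⟩
    intro j
    rcases le_total J j with hj | hj
    · exact hVJ j hj
    · exact hdown (J - j) j (by omega)
  obtain ⟨s, hsV, hsR⟩ := exists_path_of_levels V R hV hR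
  choose m hm hms using hsR
  have hs0 : s 0 = 𝔸.init := by
    obtain ⟨τ, hτ, -⟩ := hsV 0
    by_contra hne
    have : (ρ 0).stack (s 0) = none := if_neg hne
    simp [this] at hτ
  have heven : Even x.level := (hreg J).even x ((hreg J).mem_control (hplay J le_rfl))
  refine IsMacroRun.mem_language ⟨hs0, hm⟩ ⟨x.level, heven, ?_, ?_⟩
  · rw [Filter.frequently_atTop]
    by_contra! hcon
    obtain ⟨N, hN⟩ := hcon
    have hlt : ∀ j, J ≤ j → N ≤ j → m j < x.level := fun j h1 h2 =>
      lt_of_le_of_ne (hms j h1).1 (hN j h2)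
    obtain ⟨j₀, hj₀, hg₀⟩ := hgr (max J N + 1)
    obtain ⟨i, rfl⟩ : ∃ i, j₀ = i + 1 := ⟨j₀ - 1, by omega⟩
    have hT : ∀ d, T (i + 1 + d) (s (i + 1 + d)) := by
      intro d
      induction d with
      | zero => exact fun τ hτ => isTop_of_green hg₀ hτ
      | succ d ih =>
        exact ((hms (i + 1 + d) (by omega)).2 ih (hlt _ (by omega) (by omega))).1
    obtain ⟨j₁, hj₁, hg₁⟩ := hgr (i + 2)
    obtain ⟨d, rfl⟩ : ∃ d, j₁ = i + 1 + d + 1 := ⟨j₁ - (i + 2), by omega⟩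
    exact ((hms (i + 1 + d) (by omega)).2 (hT d) (hlt _ (by omega) (by omega))).2 hg₁
  · exact Filter.eventually_atTop.2 ⟨J, fun j hj => (hms j hj).1⟩

end EpsParityAutomaton

namespace Safra

open Classical in
theorem idxOf_filter_le (p : Name → Bool) {x : Name} (hx : p x) (l : List Name) :
    (l.filter p).idxOf x ≤ l.idxOf x := by
  induction l with
  | nil => simp
  | cons y l ih =>
    by_cases hy : p y
    · rw [List.filter_cons_of_pos hy]
      by_cases hxy : y = x
      · simp [hxy]
      · rw [List.idxOf_cons_ne _ hxy, List.idxOf_cons_ne _ hxy]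
        exact Nat.succ_le_succ ih
    · rw [List.filter_cons_of_neg hy]
      have hxy : y ≠ x := by
        rintro rfl
        exact hy hx
      rw [List.idxOf_cons_ne _ hxy]
      exact ih.trans (Nat.le_succ _)

open Classical in
/-- Below a stack that properly extends `ξ`, every stack that starts with `ξ` properly extends
it, and the next names are ordered. -/
theorem exists_next_of_stackLT {θ : Control} {ξ τ r : Stack} {y : Name} (hξ : ξ <+: τ)
    (h : τ = ξ ++ y :: r ∨ stackLT θ τ (ξ ++ y :: r)) :
    ∃ z r', τ = ξ ++ z :: r' ∧
      (z = y ∨ y.level < z.level ∨ (z.level = y.level ∧ θ.idxOf z < θ.idxOf y)) := by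
  obtain ⟨t, rfl⟩ := hξ
  rcases h with h | h
  · exact ⟨y, r, h, Or.inl rfl⟩
  · induction ξ with
    | cons x ξ ih =>
      simp only [List.cons_append, stackLT, if_true] at h
      obtain ⟨z, r', h1, h2⟩ := ih h
      exact ⟨z, r', by rw [List.cons_append, h1, List.cons_append], h2⟩
    | nil =>
      rcases t with _ | ⟨z, t⟩
      · simp [stackLT] at h
      · refine ⟨z, t, rfl, ?_⟩
        simp only [List.nil_append, stackLT] at h
        split_ifs at h with hzy
        · exact Or.inl hzy
        · exact Or.inr h

theorem filter_append_of_level_le {ξ : Stack} {m k : ℕ} (hm : m ≤ k)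
    (h : ∀ x ∈ ξ, k ≤ x.level) (t : Stack) :
    (ξ ++ t).filter (fun x => m ≤ x.level) = ξ ++ t.filter (fun x => m ≤ x.level) := by
  rw [List.filter_append, List.filter_eq_self.2]
  intro x hx
  exact decide_eq_true (hm.trans (h x hx))

namespace IsRegistration

theorem eq_of_level_le {θ : Control} {ξ r υ : Stack} {y : Name} {m k : ℕ}
    (h : IsRegistration θ (ξ ++ y :: r) m υ) (hm : m ≤ k) (hξ : ∀ x ∈ ξ, k ≤ x.level)
    (hy : k ≤ y.level) : ∃ r', υ = ξ ++ y :: r' := by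
  obtain ⟨ν, rfl, -, -⟩ := h
  rw [filter_append_of_level_le hm hξ, List.filter_cons_of_pos (by simpa using hm.trans hy)]
  exact ⟨r.filter (fun x => m ≤ x.level) ++ ν, by simp⟩

theorem exists_next_of_even {θ : Control} {ξ τ υ : Stack} {k : ℕ}
    (h : IsRegistration θ τ k υ) (hk : Even k) (hp : ξ <+: τ) (hξ : ∀ x ∈ ξ, k ≤ x.level) :
    ∃ y r', υ = ξ ++ y :: r' ∧ k ≤ y.level := by
  obtain ⟨t, rfl⟩ := hp
  obtain ⟨ν, rfl, -, he⟩ := h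
  obtain ⟨y, ν', rfl, hy⟩ := he hk
  rw [filter_append_of_level_le le_rfl hξ]
  rcases ht : t.filter (fun x => k ≤ x.level) with _ | ⟨z, t'⟩
  · exact ⟨y, ν', by rw [ht, List.append_nil], hy.ge⟩
  · have hz : z ∈ t.filter (fun x => k ≤ x.level) := by simp [ht]
    exact ⟨z, t' ++ y :: ν', by rw [ht, List.append_assoc, List.cons_append],
      of_decide_eq_true (List.mem_filter.1 hz).2⟩

end IsRegistration

end Safra

namespace EpsParityAutomaton

open Safra

variable {Sig A : Type*} [Fintype A]

open Classical in
/-- The rank of a name relative to a control. For stacks that occur in Safra-states, smaller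
stacks have names of smaller rank at the first difference. -/
noncomputable def rank (𝔸 : EpsParityAutomaton Sig A) (θ : Control) (x : Name) : ℕ ×ₗ ℕ :=
  toLex ((Finset.univ : Finset A).sup 𝔸.prio - x.level, θ.idxOf x)

theorem exists_stack_of_macroStep {𝔸 : EpsParityAutomaton Sig A} {S : State A}
    (hS : 𝔸.IsRegular S) {z : Sig} {a c : A} {τ : Stack} {m : ℕ} (ha : S.stack a = some τ)
    (hm : 𝔸.MacroStep z a m c) :
    ∃ υ τ', IsRegistration S.control τ m υ ∧ 𝔸.safraThin S z c = some τ' ∧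
      (τ' = υ ∨ stackLT (𝔸.safraEps S z).1 τ' υ) ∧
      (𝔸.safraNext S z).stack c = some (cut (Invisible (𝔸.safraThin S z)) τ') := by
  obtain ⟨υ, hυ, hr⟩ := exists_mem_safraEps ha hm
  obtain ⟨τ', hτ'⟩ := exists_thin_eq_some (θ := (𝔸.safraEps S z).1) hυ
  have hspec := thin_spec hτ'
  have hcoh := coherent_safraEps (𝔸 := 𝔸) hS.coherent z
  refine ⟨υ, τ', hr, hτ', ?_, ?_⟩
  · rcases stackLT_total (hcoh.mem_control τ' ⟨c, hspec.1⟩) (hcoh.mem_control υ ⟨c, hυ⟩) with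
      h | h | h
    · exact Or.inl h
    · exact Or.inr h
    · exact absurd h (hspec.2 υ hυ)
  · exact congrArg (Option.map _) hτ'

/-- If a prefix `ξ` of the stack persists in a transition without being reset, then the next name
persists as well or is replaced by a name of smaller rank; moreover there is a next name if the
priority of the macro step is even and minimal. -/
theorem next_name_step {𝔸 : EpsParityAutomaton Sig A} {S : State A} (hS : 𝔸.IsRegular S)
    {z : Sig} {a c : A} {τ τ₂ ξ : Stack} {m k : ℕ} (ha : S.stack a = some τ)
    (hm : 𝔸.MacroStep z a m c) (hc : (𝔸.safraNext S z).stack c = some τ₂) (hξ : ξ <+: τ)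
    (hξ₂ : ξ <+: τ₂)
    (hk : ∀ x ∈ ξ, k ≤ x.level ∧ (𝔸.safraNext S z).colour x ≠ Colour.green) (hmk : m ≤ k) :
    (∀ y r, τ = ξ ++ y :: r → k ≤ y.level → ∃ x r', τ₂ = ξ ++ x :: r' ∧ k ≤ x.level ∧
      𝔸.rank (𝔸.safraNext S z).control x ≤ 𝔸.rank S.control y ∧
      (𝔸.rank (𝔸.safraNext S z).control x = 𝔸.rank S.control y → x = y)) ∧
    (m = k → Even k → ∃ x r', τ₂ = ξ ++ x :: r' ∧ k ≤ x.level) := by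
  classical
  obtain ⟨υ, τ', hr, hthin, hle, hc'⟩ := exists_stack_of_macroStep hS ha hm
  obtain rfl : τ₂ = cut (Invisible (𝔸.safraThin S z)) τ' := Option.some.inj (hc.symm.trans hc')
  have hξ' : ξ <+: τ' := hξ₂.trans (cut_prefix _ _)
  have hvis : ∀ x ∈ ξ, ¬ Invisible (𝔸.safraThin S z) x := fun x hx hinv =>
    (hk x hx).2 (green_iff.2 ⟨hinv, c, _, hc, hξ₂.subset hx⟩)
  have key : ∀ y r, υ = ξ ++ y :: r → ∃ x r',
      cut (Invisible (𝔸.safraThin S z)) τ' = ξ ++ x :: r' ∧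
      (x = y ∨ y.level < x.level ∨ (x.level = y.level ∧
        (𝔸.safraEps S z).1.idxOf x < (𝔸.safraEps S z).1.idxOf y)) := by
    rintro y r rfl
    obtain ⟨x, r', rfl, hx⟩ := exists_next_of_stackLT hξ' hle
    obtain ⟨s, hs, -⟩ := exists_cut_cons (Invisible (𝔸.safraThin S z)) x r'
    exact ⟨x, s, by rw [cut_append hvis, hs], hx⟩
  constructor
  · rintro y r rfl hy
    obtain ⟨r₁, hr₁⟩ := hr.eq_of_level_le hmk (fun x hx => (hk x hx).1) hy
    obtain ⟨x, r', hcut, hx⟩ := key y r₁ hr₁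
    have hplay : InPlay (𝔸.safraNext S z).stack x := ⟨c, _, hc, by simp [hcut]⟩
    have hreg := hS.next z
    have hlx := hreg.level_le x (hreg.mem_control hplay)
    have hyc : y ∈ S.control := hS.coherent.mem_control _ ⟨a, ha⟩ y (by simp)
    have hidx : (𝔸.safraNext S z).control.idxOf x ≤ (𝔸.safraEps S z).1.idxOf x :=
      idxOf_filter_le _ (decide_eq_true hplay) _
    have hidy : (𝔸.safraEps S z).1.idxOf y = S.control.idxOf y := by
      obtain ⟨ν, hν⟩ := 𝔸.control_prefix_safraEps S z
      rw [← hν, List.idxOf_append_of_mem hyc]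
    refine ⟨x, r', hcut, ?_, ?_, ?_⟩
    · rcases hx with rfl | hx | hx <;> omega
    · rw [rank, rank, Prod.Lex.toLex_le_toLex]
      dsimp only
      rcases hx with rfl | hx | hx
      · exact Or.inr ⟨rfl, by omega⟩
      · exact Or.inl (by omega)
      · exact Or.inr ⟨by rw [hx.1], by omega⟩
    · intro he
      simp only [rank, EmbeddingLike.apply_eq_iff_eq, Prod.mk.injEq] at he
      rcases hx with rfl | hx | hx
      · rfl
      · omega
      · omega
  · rintro rfl he
    obtain ⟨y, r₁, hr₁, hy⟩ := hr.exists_next_of_even he hξ (fun x hx => (hk x hx).1)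
    obtain ⟨x, r', hcut, hx⟩ := key y r₁ hr₁
    refine ⟨x, r', hcut, ?_⟩
    rcases hx with rfl | hx | hx <;> omega

/-- If a prefix of the stacks along an accepting macro run persists and none of its names is reset
any more, then it can be extended to a longer persisting prefix. -/
theorem exists_longer_prefix {𝔸 : EpsParityAutomaton Sig A} {w : ℕ → Sig} {s : ℕ → A}
    {m : ℕ → ℕ} (hs : 𝔸.IsMacroRun w s m) {k : ℕ} (hk : Even k)
    (hfreq : ∃ᶠ j in Filter.atTop, m j = k) (hev : ∀ᶠ j in Filter.atTop, m j ≤ k)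
    {σ : ℕ → Stack} (hσ : ∀ j, (𝔸.safra.run w j).stack (s j) = some (σ j)) {ξ : Stack}
    (hξk : ∀ x ∈ ξ, k ≤ x.level) (hξ : ∀ᶠ j in Filter.atTop, ξ <+: σ j)
    (hwhite : ∀ᶠ j in Filter.atTop, ∀ x ∈ ξ, (𝔸.safra.run w j).colour x ≠ Colour.green) :
    ∃ y, k ≤ y.level ∧ ∀ᶠ j in Filter.atTop, ξ ++ [y] <+: σ j := by
  obtain ⟨J, hJ⟩ := Filter.eventually_atTop.1 (hev.and (hξ.and hwhite))
  have hstep := fun j (hj : J ≤ j) => next_name_step (𝔸.isRegular_run w j) (k := k) (hσ j)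
    (hs.step j) (hσ (j + 1)) (hJ j hj).2.1 (hJ (j + 1) (by omega)).2.1
    (fun x hx => ⟨hξk x hx, (hJ (j + 1) (by omega)).2.2 x hx⟩) (hJ j hj).1
  obtain ⟨j₀, hj₀, hmk⟩ := Filter.frequently_atTop.1 hfreq J
  have hex : ∀ i, ∃ y r, σ (j₀ + 1 + i) = ξ ++ y :: r ∧ k ≤ y.level := by
    intro i
    induction i with
    | zero => exact (hstep j₀ hj₀).2 hmk hk
    | succ i ih =>
      obtain ⟨y, r, h1, h2⟩ := ih
      obtain ⟨x, r', h3, h4, -⟩ := (hstep (j₀ + 1 + i) (by omega)).1 y r h1 h2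
      exact ⟨x, r', h3, h4⟩
  choose y r hy hyk using hex
  let f : ℕ → ℕ ×ₗ ℕ := fun i => 𝔸.rank (𝔸.safra.run w (j₀ + 1 + i)).control (y i)
  have hf : ∀ i, f (i + 1) ≤ f i ∧ (f (i + 1) = f i → y (i + 1) = y i) := by
    intro i
    obtain ⟨x, r', h3, -, h5⟩ := (hstep (j₀ + 1 + i) (by omega)).1 (y i) (r i) (hy i) (hyk i)
    have : y (i + 1) :: r (i + 1) = x :: r' :=
      List.append_cancel_left ((hy (i + 1)).symm.trans h3)
    obtain ⟨rfl, -⟩ := List.cons.inj this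
    exact h5
  obtain ⟨n, hn⟩ := WellFoundedGT.monotone_chain_condition (α := (ℕ ×ₗ ℕ)ᵒᵈ)
    ⟨fun i => OrderDual.toDual (f i), monotone_nat_of_le_succ fun i => (hf i).1⟩
  have hconst : ∀ d, y (n + d) = y n := by
    intro d
    induction d with
    | zero => rfl
    | succ d ih =>
      rw [← ih]
      refine (hf (n + d)).2 ?_
      have h1 : f n = f (n + d) := hn (n + d) (by omega)
      have h2 : f n = f (n + d + 1) := hn (n + d + 1) (by omega)
      exact h2.symm.trans h1
  refine ⟨y n, hyk n, Filter.eventually_atTop.2 ⟨j₀ + 1 + n, fun j hj => ?_⟩⟩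
  obtain ⟨d, rfl⟩ : ∃ d, j = j₀ + 1 + (n + d) := ⟨j - (j₀ + 1 + n), by omega⟩
  rw [hy, hconst]
  exact ⟨r (n + d), by simp⟩

theorem mem_safra_language_of_isMacroRun {𝔸 : EpsParityAutomaton Sig A} {w : ℕ → Sig}
    {s : ℕ → A} {m : ℕ → ℕ} (hs : 𝔸.IsMacroRun w s m) (hm : ParityCondition m) :
    w ∈ 𝔸.safra.language := by
  obtain ⟨k, hk, hfreq, hev⟩ := hm
  have hex : ∀ j, ∃ τ, (𝔸.safra.run w j).stack (s j) = some τ := by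
    intro j
    induction j with
    | zero => exact ⟨[], if_pos hs.init⟩
    | succ j ih =>
      obtain ⟨τ, hτ⟩ := ih
      obtain ⟨υ, τ', -, -, -, h⟩ :=
        exists_stack_of_macroStep (𝔸.isRegular_run w j) hτ (hs.step j)
      exact ⟨_, h⟩
  choose σ hσ using hex
  by_contra hrej
  have hrej' : ∀ x : Name, (∀ᶠ j in Filter.atTop, InPlay (𝔸.safra.run w j).stack x) →
      ∀ᶠ j in Filter.atTop, (𝔸.safra.run w j).colour x ≠ Colour.green := by
    intro x hx
    by_contra hcon
    exact hrej ⟨x, hx, hcon⟩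
  have hprefix : ∀ h : ℕ, ∃ ξ : Stack, ξ.length = h ∧ (∀ x ∈ ξ, k ≤ x.level) ∧
      ∀ᶠ j in Filter.atTop, ξ <+: σ j := by
    intro h
    induction h with
    | zero => exact ⟨[], rfl, by simp, by simp⟩
    | succ h ih =>
      obtain ⟨ξ, hlen, hξk, hξ⟩ := ih
      have hwhite : ∀ᶠ j in Filter.atTop,
          ∀ x ∈ ξ, (𝔸.safra.run w j).colour x ≠ Colour.green := by
        refine (Filter.eventually_all_finite (List.finite_toSet ξ)).2 fun x hx => hrej' x ?_
        exact hξ.mono fun j hj => ⟨s j, σ j, hσ j, hj.subset hx⟩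
      obtain ⟨y, hyk, hy⟩ := exists_longer_prefix hs hk hfreq hev hσ hξk hξ hwhite
      refine ⟨ξ ++ [y], by simp [hlen], fun x hx => ?_, hy⟩
      rcases List.mem_append.1 hx with hx | hx
      · exact hξk x hx
      · rw [List.mem_singleton] at hx
        exact hx ▸ hyk
  obtain ⟨ξ, hlen, -, hξ⟩ := hprefix (𝔸.playBound + 1)
  obtain ⟨j, hj⟩ := hξ.exists
  have h1 := (𝔸.isRegular_run w j).length_stack_le ⟨s j, hσ j⟩
  have h2 := hj.length_le
  omega

end EpsParityAutomaton

theorem mainTheorem4 {Sig A : Type*} [Fintype A] (𝔸 : EpsParityAutomaton Sig A)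
    (hinit : 𝔸.eps 𝔸.init = ∅) :
    {S : Safra.State A | 𝔸.safra.Reachable S}.Finite ∧ 𝔸.safra.language = 𝔸.language := by
  refine ⟨𝔸.finite_reachable, 𝔸.safra_language_subset.antisymm fun w hw => ?_⟩
  obtain ⟨s, m, hs, hm⟩ := EpsParityAutomaton.exists_isMacroRun hinit hw
  exact EpsParityAutomaton.mem_safra_language_of_isMacroRun hs hm
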